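/- **Setting.** Let $B\subseteq\mathbb R^{d'}$, $f:\mathbb R^d\times B\to\mathbb R^d$, $h:\mathbb R^d\times B\to\mathbb R$, $g:\mathbb R^d\to\mathbb R$, $T>0$, $x_0\in\mathbb R^d$. The value function is $$u(x,t)=\inf\Big\{\int_t^T h(X(s),\alpha(s))\,ds+g(X(T))\Big\},$$ the infimum being over all functions $\alpha:[t,T]\to B$ and absolutely continuous $X:[t,T]\to\mathbb R^d$ with $X'=f(X,\alpha)$ a.e., $X(t)=x$, and $s\mapsto h(X(s),\alpha(s))$ integrable. Let $H(x,\lambda)=\min_{\alpha\in B}\{\lambda\cdot f(x,\alpha)+h(x,\alpha)\}$ (the minimum is attained for all $x,\lambda\in\mathbb R^d$), and let $H_\lambda,H_x$ be its partial gradients. Put $L(x,\beta)=\sup_{\lambda\in\mathbb R^d}(-\beta\cdot\lambda+H(x,\lambda))\in\mathbb R\cup\{+\infty\}$. A function is called *bounded in $C^k$* on an open set if it is $C^k$ there and its derivatives of orders $1,\dots,k$ are bounded there. For a discretization $0=t_0<t_1<\dots<t_N=T$ let $\Delta t_n=t_{n+1}-t_n$, $\Delta t_{\max}=\max_n\Delta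 t_n$, and $$\bar u(x_0,0)=\inf_{\beta_0,\dots,\beta_{N-1}\in\mathbb R^d}\Big\{\sum_{n=0}^{N-1}\Delta t_n L(X_n,\beta_n)+g(X_N)\Big\},\qquad X_0=x_0,\quad X_{n+1}=X_n+\Delta t_n\beta_n .$$ The superdifferential $D^+g(x)$ is the set of $p$ with $\limsup_{y\to x}\frac{g(y)-g(x)-p\cdot(y-x)}{|y-x|}\le 0$. **Assumptions.** 1. $g$ is locally semiconcave, that is, for every compact $K\subset\mathbb R^d$ there is a nondecreasing upper semicontinuous $\omega:[0,\infty)\to[0,\infty)$ with $\lim_{\rho\to0^+}\omega(\rho)=0$ and $wg(x)+(1-w)g(y)-g(wx+(1-w)y)\le w(1-w)|x-y|\,\omega(|x-y|)$ for all $w\in[0,1]$ and $x,y\in K$ with $[x,y]\subset K$. Moreover $g(x)\ge-k(1+|x|)$ for some constant $k$. 2. $H$ is differentiable; $H_\lambda(\cdot,\lambda)$ is locally Lipschitz for every $\lambda$; $H_x$ is continuous; $-H(x,\lambda)\le\mu(|\lambda|)+|x|(A+B_0|\lambda|)$ for some convex nondecreasing $\mu:[0,\infty)\to\mathbb R$ and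 constants $A,B_0>0$; $H(x,\cdot)$ is concave for every $x$. 3. $H$ is bounded in $C^2(\mathbb R^d\times\mathbb R^d)$. 4. For every discretization let $(X_n)_{n=0}^N$ be a minimizing path in the definition of $\bar u(x_0,0)$ and $(\lambda_n)_{n=0}^N$ a corresponding discrete dual path, i.e. $\lambda_N\in D^+g(X_N)$ and, for $0\le n<N$, $$X_{n+1}=X_n+\Delta t_nH_\lambda(X_n,\lambda_{n+1}),\qquad \lambda_n=\lambda_{n+1}+\Delta t_nH_x(X_n,\lambda_{n+1}).$$ There is a constant $C$ such that for every discretization $|\lambda_n-u_x(X_n,t_n)|\le C\,\Delta t_{\max}$ for all $0\le n\le N$ for which the gradient $u_x(X_n,t_n)$ exists. Let $\rho_n=-\tfrac12 H_\lambda(X_n,\lambda_{n+1})\cdot H_x(X_n,\lambda_{n+1})$. **Theorem.** (i) If $u$ is bounded in $C^3((0,T)\times\mathbb R^d)$, then there is a constant $C'$ such that for every discretization $\bar u(x_0,0)$ and $u(x_0,0)$ are finite and $$\bar u(x_0,0)-u(x_0,0)=\sum_{n=0}^{N-1}\Delta t_n^2\rho_n+R,\qquad |R|\le C'\,\Delta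 t_{\max}^2. \tag{$*$}$$ (ii) Suppose instead that there are a minimizing path $X:[0,T]\to\mathbb R^d$ for $u(x_0,0)$ and an $\varepsilon>0$ such that $u$ is bounded in $C^3$ on $\{(x,t):0<t<T,\ |x-X(t)|<\varepsilon\}$, and that $\max_n|X_n-X(t_n)|\to0$ as $\Delta t_{\max}\to0$. Then there are $\Delta t_{\mathrm{thres}}>0$ and a constant $C'$ such that $(*)$ holds for every discretization with $\Delta t_{\max}\le\Delta t_{\mathrm{thres}}$. -/

import Mathlib

noncomputable section

namespace SymplecticEuler

/-- Euclidean space of dimension `d`. -/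
abbrev Vec (d : ℕ) := EuclideanSpace ℝ (Fin d)

/-! ### Regularity notions -/

/-- A real function `v` is bounded in `C^k` on the open set `U`: it is `C^k` on `U` and its
derivatives of the orders `1, …, k` are bounded on `U`. -/
def BoundedCk {P : Type*} [NormedAddCommGroup P] [NormedSpace ℝ P]
    (k : ℕ) (v : P → ℝ) (U : Set P) : Prop :=
  ContDiffOn ℝ (k : ℕ∞) v U ∧
    ∃ M : ℝ, ∀ j : ℕ, 1 ≤ j → j ≤ k → ∀ p ∈ U, ‖iteratedFDeriv ℝ j v p‖ ≤ M

/-- An extended-real function `w` is real-valued on the open set `U` and bounded in `C^k` there. -/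
def EBoundedCk {P : Type*} [NormedAddCommGroup P] [NormedSpace ℝ P]
    (k : ℕ) (w : P → EReal) (U : Set P) : Prop :=
  ∃ v : P → ℝ, (∀ p ∈ U, w p = (v p : EReal)) ∧ BoundedCk k v U

/-- The extended-real function `w` is real-valued near `x` and has the gradient `p` at `x`. -/
def EHasGradientAt {d : ℕ} (w : Vec d → EReal) (p x : Vec d) : Prop :=
  ∃ v : Vec d → ℝ, (∀ᶠ y in nhds x, w y = (v y : EReal)) ∧ HasGradientAt v p x

/-- Semiconcavity of `φ` on `S`, with a modulus `ω : [0,∞) → [0,∞)`. -/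
def Semiconcave {d : ℕ} (S : Set (Vec d)) (φ : Vec d → ℝ) : Prop :=
  ∃ ω : ℝ → ℝ,
    (∀ r, 0 ≤ r → 0 ≤ ω r) ∧
    MonotoneOn ω (Set.Ici 0) ∧
    UpperSemicontinuousOn ω (Set.Ici 0) ∧
    Filter.Tendsto ω (nhdsWithin 0 (Set.Ioi 0)) (nhds 0) ∧
    ∀ x ∈ S, ∀ y ∈ S, segment ℝ x y ⊆ S → ∀ w : ℝ, 0 ≤ w → w ≤ 1 →
      w * φ x + (1 - w) * φ y - φ (w • x + (1 - w) • y)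
        ≤ w * (1 - w) * ‖x - y‖ * ω ‖x - y‖

/-- Local semiconcavity on the whole space: semiconcavity on every compact set. -/
def LocallySemiconcave {d : ℕ} (φ : Vec d → ℝ) : Prop :=
  ∀ K : Set (Vec d), IsCompact K → Semiconcave K φ

/-- The superdifferential `D⁺ φ(x)`:
`limsup_{y → x} (φ(y) - φ(x) - p·(y-x)) / |y-x| ≤ 0`, written with `ε`. -/
def superdifferential {d : ℕ} (φ : Vec d → ℝ) (x : Vec d) : Set (Vec d) :=
  {p | ∀ ε : ℝ, 0 < ε → ∀ᶠ y in nhds x, φ y - φ x - inner ℝ p (y - x) ≤ ε * ‖y - x‖}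

/-! ### The optimal control problem -/

/-- Data of the problem: minimize `∫₀ᵀ h(X,α) dt + g(X(T))` subject to `X' = f(X,α)`, where the
control `α` takes its values in `B ⊆ ℝ^m` (only the values of `f x`, `h x` on `B` matter). -/
structure ControlProblem (d m : ℕ) where
  /-- control set -/
  B : Set (Vec m)
  /-- flux -/
  f : Vec d → Vec m → Vec d
  /-- running cost -/
  h : Vec d → Vec m → ℝ
  /-- terminal cost -/
  g : Vec d → ℝ
  /-- final time -/
  T : ℝ

variable {d m : ℕ}

/-- `(X, α)` is an admissible state-control pair on `[t, T]` that starts in `x`: `α` is `B`-valued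
and `X` is an absolutely continuous solution of `X' = f(X, α)`, `X(t) = x` (in integral form),
with integrable running cost. -/
structure ControlProblem.Admissible (P : ControlProblem d m) (x : Vec d) (t : ℝ)
    (X : ℝ → Vec d) (α : ℝ → Vec m) : Prop where
  control_mem : ∀ s ∈ Set.Icc t P.T, α s ∈ P.B
  flux_integrable :
    IntervalIntegrable (fun s => P.f (X s) (α s)) MeasureTheory.volume t P.T
  state_eq : ∀ s ∈ Set.Icc t P.T, X s = x + ∫ r in t..s, P.f (X r) (α r)
  cost_integrable :
    IntervalIntegrable (fun s => P.h (X s) (α s)) MeasureTheory.volume t P.T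

/-- The objective functional on `[t, T]`. -/
def ControlProblem.cost (P : ControlProblem d m) (t : ℝ)
    (X : ℝ → Vec d) (α : ℝ → Vec m) : ℝ :=
  (∫ s in t..P.T, P.h (X s) (α s)) + P.g (X P.T)

/-- The value function `u(x,t)`, an infimum in the extended reals. -/
def ControlProblem.value (P : ControlProblem d m) (x : Vec d) (t : ℝ) : EReal :=
  ⨅ (X : ℝ → Vec d) (α : ℝ → Vec m) (_ : P.Admissible x t X α), ((P.cost t X α : ℝ) : EReal)

/-- `X` is a minimizing path for `u(x,t)`. -/
def ControlProblem.IsOptimalPath (P : ControlProblem d m) (x : Vec d) (t : ℝ)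
    (X : ℝ → Vec d) : Prop :=
  ∃ α : ℝ → Vec m, P.Admissible x t X α ∧ ((P.cost t X α : ℝ) : EReal) = P.value x t

/-- `H(x,l) = min_{a ∈ B} { l · f(x,a) + h(x,a) }`, the minimum being attained. -/
def ControlProblem.IsHamiltonian (P : ControlProblem d m) (H : Vec d → Vec d → ℝ) : Prop :=
  ∀ x l, IsLeast ((fun a => inner ℝ l (P.f x a) + P.h x a) '' P.B) (H x l)

/-! ### The Hamiltonian and its Legendre-type transform -/

/-- The partial gradient `H_λ(x,l)`. -/
def gradLam (H : Vec d → Vec d → ℝ) (x l : Vec d) : Vec d := gradient (fun l' => H x l') l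

/-- The partial gradient `H_x(x,l)`. -/
def gradX (H : Vec d → Vec d → ℝ) (x l : Vec d) : Vec d := gradient (fun x' => H x' l) x

/-- `L(x,b) = sup_l (-b·l + H(x,l))`, with values in the extended reals. -/
def legendre (H : Vec d → Vec d → ℝ) (x b : Vec d) : EReal :=
  ⨆ l : Vec d, ((-inner ℝ b l + H x l : ℝ) : EReal)

/-- Standing conditions on the terminal cost and the Hamiltonian. -/
structure StandingConditions (g : Vec d → ℝ) (H : Vec d → Vec d → ℝ) : Prop where
  g_semiconcave : LocallySemiconcave g
  g_lower : ∃ k : ℝ, ∀ x, -k * (1 + ‖x‖) ≤ g x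
  H_differentiable : Differentiable ℝ (fun p : Vec d × Vec d => H p.1 p.2)
  H_lam_locallyLipschitz : ∀ l, LocallyLipschitz (fun x => gradLam H x l)
  H_x_continuous : Continuous (fun p : Vec d × Vec d => gradX H p.1 p.2)
  H_growth : ∃ (μ : ℝ → ℝ) (A B : ℝ), ConvexOn ℝ (Set.Ici 0) μ ∧ MonotoneOn μ (Set.Ici 0) ∧
    0 < A ∧ 0 < B ∧ ∀ x l, -H x l ≤ μ ‖l‖ + ‖x‖ * (A + B * ‖l‖)
  H_concave : ∀ x, ConcaveOn ℝ Set.univ (H x)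

/-! ### Discretizations and the discrete problem -/

/-- A discretization `0 = t_0 < t_1 < … < t_N = T`. Only `t 0, …, t N` are used. -/
structure TimeGrid (T : ℝ) where
  /-- number of steps -/
  N : ℕ
  /-- nodes -/
  t : ℕ → ℝ
  t_zero : t 0 = 0
  t_last : t N = T
  t_lt : ∀ n, n < N → t n < t (n + 1)

/-- The step `Δt_n = t_{n+1} - t_n`. -/
def TimeGrid.dt {T : ℝ} (G : TimeGrid T) (n : ℕ) : ℝ := G.t (n + 1) - G.t n

/-- The largest step `Δt_max`. -/
def TimeGrid.dtMax {T : ℝ} (G : TimeGrid T) : ℝ := ⨆ n : Fin G.N, G.dt n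

/-- The discrete path with `X_k = y` and `X_{n+1} = X_n + Δt_n β_n` for `n ≥ k`. -/
def discretePath {T : ℝ} (G : TimeGrid T) (k : ℕ) (y : Vec d) (β : ℕ → Vec d) (n : ℕ) : Vec d :=
  y + ∑ i ∈ Finset.Ico k n, G.dt i • β i

/-- The discrete cost `J_{(y,t_k)}(β_k, …, β_{N-1})`. -/
def discreteCost (g : Vec d → ℝ) (H : Vec d → Vec d → ℝ) {T : ℝ} (G : TimeGrid T) (k : ℕ)
    (y : Vec d) (β : ℕ → Vec d) : EReal :=
  (∑ n ∈ Finset.Ico k G.N, (G.dt n : EReal) * legendre H (discretePath G k y β n) (β n))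
    + (g (discretePath G k y β G.N) : EReal)

/-- The discrete value function `ū(y, t_k)`. -/
def discreteValue (g : Vec d → ℝ) (H : Vec d → Vec d → ℝ) {T : ℝ} (G : TimeGrid T) (k : ℕ)
    (y : Vec d) : EReal :=
  ⨅ β : ℕ → Vec d, discreteCost g H G k y β

/-- `(X_0, …, X_N)` is a minimizing path of the discrete problem started in `x₀` at time `0`, and
`(λ_0, …, λ_N)` is a corresponding discrete dual path: together they solve the symplectic Euler
scheme, with `λ_N` in the superdifferential of `g` at `X_N`. -/
structure IsDiscreteSolution (g : Vec d → ℝ) (H : Vec d → Vec d → ℝ) (x₀ : Vec d) {T : ℝ}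
    (G : TimeGrid T) (X lam : ℕ → Vec d) : Prop where
  minimizing : ∃ β : ℕ → Vec d,
    (∀ γ : ℕ → Vec d, discreteCost g H G 0 x₀ β ≤ discreteCost g H G 0 x₀ γ) ∧
    ∀ n, n ≤ G.N → X n = discretePath G 0 x₀ β n
  initial : X 0 = x₀
  state_step : ∀ n, n < G.N → X (n + 1) = X n + G.dt n • gradLam H (X n) (lam (n + 1))
  terminal : lam G.N ∈ superdifferential g (X G.N)
  dual_step : ∀ n, n < G.N → lam n = lam (n + 1) + G.dt n • gradX H (X n) (lam (n + 1))

/-- The error density `ρ_n = - H_λ(X_n,λ_{n+1}) · H_x(X_n,λ_{n+1}) / 2`. -/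
def errorDensity (H : Vec d → Vec d → ℝ) (X lam : ℕ → Vec d) (n : ℕ) : ℝ :=
  -inner ℝ (gradLam H (X n) (lam (n + 1))) (gradX H (X n) (lam (n + 1))) / 2

/-- The error representation on the grid `G`: the two values are finite and
`ū(x₀,0) - u(x₀,0) = ∑ Δt_n² ρ_n + R` with `|R| ≤ C' Δt_max²`. -/
def ErrorRepresentation (P : ControlProblem d m) (H : Vec d → Vec d → ℝ) (x₀ : Vec d)
    (G : TimeGrid P.T) (X lam : ℕ → Vec d) (C' : ℝ) : Prop :=
  ∃ ubar u R : ℝ,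
    discreteValue P.g H G 0 x₀ = (ubar : EReal) ∧
    P.value x₀ 0 = (u : EReal) ∧
    ubar - u = (∑ n ∈ Finset.range G.N, G.dt n ^ 2 * errorDensity H X lam n) + R ∧
    |R| ≤ C' * G.dtMax ^ 2

/-- First alternative: the value function is bounded in `C^3((0,T) × ℝ^d)`. -/
def GloballySmoothValue (P : ControlProblem d m) : Prop :=
  EBoundedCk 3 (fun p : Vec d × ℝ => P.value p.1 p.2) {p | p.2 ∈ Set.Ioo 0 P.T}

/-- Second alternative: for a minimizing path `Z` of `u(x₀,0)`, the value function is bounded in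
`C^3` on a tube around `Z` (the points reached, at times in `(0,T)`, by the paths at uniform
distance less than `ε` from `Z`), and the discrete paths `X G` converge to `Z` as `Δt_max → 0`. -/
def SmoothNearOptimalPath (P : ControlProblem d m) (x₀ : Vec d)
    (X : TimeGrid P.T → ℕ → Vec d) : Prop :=
  ∃ Z : ℝ → Vec d, P.IsOptimalPath x₀ 0 Z ∧
    (∃ ε : ℝ, 0 < ε ∧ EBoundedCk 3 (fun p : Vec d × ℝ => P.value p.1 p.2)
      {p | p.2 ∈ Set.Ioo 0 P.T ∧ ‖p.1 - Z p.2‖ < ε}) ∧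
    ∀ η : ℝ, 0 < η → ∃ δ : ℝ, 0 < δ ∧ ∀ G : TimeGrid P.T, G.dtMax < δ →
      ∀ n, n ≤ G.N → ‖X G n - Z (G.t n)‖ < η

end SymplecticEuler

end

/-!
The proof compares the discrete path with the value function `u` along the polygon through the
nodes `X_n`.

*The Hamiltonian determines the controls.* Since `H(x,·)` is a minimum of affine functions and
is differentiable, a minimizing control at `(x,λ)` has flux `H_λ(x,λ)` (`exists_control`). Since
`H` is Lipschitz in `λ` with a constant `M`, every flux is bounded by `M` (`norm_flux_le`).
Hence all admissible paths are `M`-Lipschitz, and the feedback paths `X' = H_λ(X,p)` are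
admissible (`exists_feedback`). Dynamic programming with these two facts gives `u_t + H(x,u_x) = 0`
wherever `u` is differentiable (`hamiltonJacobi`), finiteness of `u(x₀,0)` together with
continuity there (`exists_value_initial`), and continuity at the terminal time
(`value_continuous_terminal`). The last point uses that a semiconcave function that is bounded
below is continuous.

*One step.* Put `β = H_λ(X_n,λ_{n+1})`. By duality `L(X_n,β) = H(X_n,λ_{n+1}) - λ_{n+1} · β`.
Along the segment `Y` from `X_n` to `X_{n+1}` the value changes at the rate `p · β - H(Y,p)`
with `p = u_x`, by the Hamilton-Jacobi equation. Expanding `H` at `(X_n,λ_{n+1})`, the terms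
linear in `p - λ_{n+1}` cancel. As `p - λ_{n+1} = O(Δt_max)`, what remains is the linear term in
`Y - X_n`, which contributes `Δt_n² ρ_n`, and an error `O(Δt_max²)` per unit of time
(`SmoothValueOn.abs_local_error_le`). No third derivatives of `u` enter.

*Summation.* Telescoping `u(X_n,t_n)` from `u(x₀,0)` to `g(X_N)` gives the representation
(`SmoothValueOn.exists_errorRepresentation`), uniformly for a value function that is smooth in a
tube around a Lipschitz path. The estimate of `λ_n - u_x(X_n,t_n)` is used only at nodes in
`(0,T)`; every step has such an endpoint unless `N = 1`. In the globally smooth case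
the tube is one around a constant path, wide enough to contain all discrete paths, and grids with
`N = 1` are treated separately (`exists_errorRepresentation_of_N_eq_one`).
-/

open Set Filter Topology MeasureTheory
open scoped Interval NNReal

namespace SymplecticEuler

variable {d m : ℕ} {P : ControlProblem d m} {H : Vec d → Vec d → ℝ} {M : ℝ}

/-! ### Bounds on the Hamiltonian -/

/-- The quantitative consequences of `H` being bounded in `C²`: a single constant `M` bounds the
partial gradients, is a Lipschitz constant of `H` and of `H_λ`, and controls the remainder of the
first-order Taylor expansion of `H`. -/
structure HamiltonianBounds {d : ℕ} (H : Vec d → Vec d → ℝ) (M : ℝ) : Prop where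
  nonneg : 0 ≤ M
  hasGradientAt_lam : ∀ x l, HasGradientAt (H x) (gradLam H x l) l
  norm_gradLam_le : ∀ x l, ‖gradLam H x l‖ ≤ M
  norm_gradX_le : ∀ x l, ‖gradX H x l‖ ≤ M
  norm_gradLam_sub_le : ∀ x y l, ‖gradLam H x l - gradLam H y l‖ ≤ M * ‖x - y‖
  abs_sub_le : ∀ x l y k, |H y k - H x l| ≤ M * (‖y - x‖ + ‖k - l‖)
  abs_taylor_le : ∀ x l y k,
    |H y k - H x l - inner ℝ (gradX H x l) (y - x) - inner ℝ (gradLam H x l) (k - l)|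
      ≤ M * (‖y - x‖ + ‖k - l‖) ^ 2

/-- A function that is bounded in `C^k` with `k ≥ 2` on an open set has its first two Fréchet
derivatives bounded there by a common constant. -/
theorem BoundedCk.exists_bound {P : Type*} [NormedAddCommGroup P] [NormedSpace ℝ P] {k : ℕ}
    (hk : 2 ≤ k) {v : P → ℝ} {U : Set P} (hU : IsOpen U) (hv : BoundedCk k v U) :
    ∃ M : ℝ, 0 ≤ M ∧ ∀ p ∈ U, DifferentiableAt ℝ v p ∧ DifferentiableAt ℝ (fderiv ℝ v) p ∧
      ‖fderiv ℝ v p‖ ≤ M ∧ ‖fderiv ℝ (fderiv ℝ v) p‖ ≤ M := by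
  obtain ⟨hc, M, hM⟩ := hv
  refine ⟨max M 0, le_max_right _ _, fun p hp => ?_⟩
  have hc2 : ContDiffAt ℝ 2 v p :=
    (hc.contDiffAt (hU.mem_nhds hp)).of_le
      (WithTop.coe_le_coe.2 (Nat.cast_le.2 hk : ((2 : ℕ) : ℕ∞) ≤ k))
  have h1 := hM 1 le_rfl (by omega) p hp
  have h2 := hM 2 (by omega) hk p hp
  rw [norm_iteratedFDeriv_one] at h1
  rw [← norm_iteratedFDeriv_fderiv (n := 1), norm_iteratedFDeriv_one] at h2
  refine ⟨hc2.differentiableAt (by norm_num), ?_, h1.trans (le_max_left _ _),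
    h2.trans (le_max_left _ _)⟩
  exact (hc2.fderiv_right (m := 1) (by norm_num)).differentiableAt (by norm_num)

theorem hasGradientAt_and_inner_gradLam {d : ℕ} {H : Vec d → Vec d → ℝ} {x l : Vec d}
    (h : DifferentiableAt ℝ (fun p : Vec d × Vec d => H p.1 p.2) (x, l)) (w : Vec d) :
    HasGradientAt (H x) (gradLam H x l) l ∧
    inner ℝ (gradLam H x l) w = fderiv ℝ (fun p : Vec d × Vec d => H p.1 p.2) (x, l) (0, w) := by
  have h1 : HasFDerivAt (fun l' : Vec d => H x l') _ l :=
    h.hasFDerivAt.comp l (hasFDerivAt_prodMk_right x l)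
  have h2 : HasGradientAt (fun l' => H x l') (gradLam H x l) l :=
    h1.differentiableAt.hasGradientAt
  refine ⟨h2, ?_⟩
  have h3 := h2.hasFDerivAt.unique h1
  have := congrArg (fun L => L w) h3
  simpa using this

theorem inner_gradX {d : ℕ} {H : Vec d → Vec d → ℝ} {x l : Vec d}
    (h : DifferentiableAt ℝ (fun p : Vec d × Vec d => H p.1 p.2) (x, l)) (w : Vec d) :
    inner ℝ (gradX H x l) w = fderiv ℝ (fun p : Vec d × Vec d => H p.1 p.2) (x, l) (w, 0) := by
  have h1 : HasFDerivAt (fun x' : Vec d => H x' l) _ x :=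
    HasFDerivAt.comp (g := fun p : Vec d × Vec d => H p.1 p.2) (f := fun x' => (x', l)) x
      h.hasFDerivAt (hasFDerivAt_prodMk_left x l)
  have h2 : HasGradientAt (fun x' => H x' l) (gradX H x l) x :=
    h1.differentiableAt.hasGradientAt
  have h3 := h2.hasFDerivAt.unique h1
  have := congrArg (fun L => L w) h3
  simpa using this

theorem norm_le_of_abs_inner_le {d : ℕ} {a : Vec d} {M : ℝ} (hM : 0 ≤ M)
    (h : ∀ w, |inner ℝ a w| ≤ M * ‖w‖) : ‖a‖ ≤ M := by
  have := h a
  rw [real_inner_self_eq_norm_sq, abs_of_nonneg (by positivity)] at this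
  by_contra hc
  push Not at hc
  nlinarith [norm_nonneg a]

theorem exists_hamiltonianBounds {d : ℕ} {H : Vec d → Vec d → ℝ}
    (h : BoundedCk 2 (fun p : Vec d × Vec d => H p.1 p.2) univ) :
    ∃ M, HamiltonianBounds H M := by
  obtain ⟨M, hM0, hM⟩ := h.exists_bound le_rfl isOpen_univ
  set F : Vec d × Vec d → ℝ := fun p => H p.1 p.2 with hF
  have hd : ∀ p, DifferentiableAt ℝ F p := fun p => (hM p trivial).1
  have hd2 : ∀ p, DifferentiableAt ℝ (fderiv ℝ F) p := fun p => (hM p trivial).2.1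
  have hb1 : ∀ p, ‖fderiv ℝ F p‖ ≤ M := fun p => (hM p trivial).2.2.1
  have hb2 : ∀ p, ‖fderiv ℝ (fderiv ℝ F) p‖ ≤ M := fun p => (hM p trivial).2.2.2
  have hlip : ∀ p q, ‖fderiv ℝ F q - fderiv ℝ F p‖ ≤ M * ‖q - p‖ := fun p q =>
    convex_univ.norm_image_sub_le_of_norm_fderiv_le (fun z _ => hd2 z) (fun z _ => hb2 z)
      trivial trivial
  have hnorm : ∀ x l y k : Vec d, ‖((y, k) : Vec d × Vec d) - (x, l)‖ ≤ ‖y - x‖ + ‖k - l‖ := by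
    intro x l y k
    rw [Prod.mk_sub_mk, Prod.norm_mk]
    exact max_le (by linarith [norm_nonneg (k - l)]) (by linarith [norm_nonneg (y - x)])
  refine ⟨M, hM0, fun x l => (hasGradientAt_and_inner_gradLam (hd _) 0).1, ?_, ?_, ?_, ?_, ?_⟩
  · intro x l
    refine norm_le_of_abs_inner_le hM0 fun w => ?_
    rw [(hasGradientAt_and_inner_gradLam (hd _) w).2, ← Real.norm_eq_abs]
    refine (ContinuousLinearMap.le_of_opNorm_le _ (hb1 _) _).trans_eq ?_
    simp
  · intro x l
    refine norm_le_of_abs_inner_le hM0 fun w => ?_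
    rw [inner_gradX (hd _) w, ← Real.norm_eq_abs]
    refine (ContinuousLinearMap.le_of_opNorm_le _ (hb1 _) _).trans_eq ?_
    simp
  · intro x y l
    refine norm_le_of_abs_inner_le (by positivity) fun w => ?_
    rw [inner_sub_left, (hasGradientAt_and_inner_gradLam (hd _) w).2,
      (hasGradientAt_and_inner_gradLam (hd _) w).2,
      ← Real.norm_eq_abs, ← _root_.sub_apply]
    refine (ContinuousLinearMap.le_of_opNorm_le _ (hlip (y, l) (x, l)) _).trans_eq ?_
    simp [Prod.norm_mk]
  · intro x l y k
    have := convex_univ.norm_image_sub_le_of_norm_fderiv_le (f := F) (x := (x, l)) (y := (y, k))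
      (fun z _ => hd z) (fun z _ => hb1 z) trivial trivial
    exact this.trans (mul_le_mul_of_nonneg_left (hnorm x l y k) hM0)
  · intro x l y k
    set p : Vec d × Vec d := (x, l)
    set q : Vec d × Vec d := (y, k)
    have key := (convex_closedBall p ‖q - p‖).norm_image_sub_le_of_norm_fderiv_le' (f := F)
      (φ := fderiv ℝ F p) (C := M * ‖q - p‖) (x := p) (y := q) (fun z _ => hd z)
      (fun z hz => (hlip p z).trans
        (mul_le_mul_of_nonneg_left (by simpa [dist_eq_norm] using hz) hM0))
      (by simp) (by simp [dist_eq_norm])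
    have hsplit : fderiv ℝ F p (q - p) =
        inner ℝ (gradX H x l) (y - x) + inner ℝ (gradLam H x l) (k - l) := by
      rw [inner_gradX (hd _), (hasGradientAt_and_inner_gradLam (hd _) _).2, ← map_add]
      simp [p, q, hF]
    rw [hsplit, Real.norm_eq_abs] at key
    calc _ = |F q - F p - (inner ℝ (gradX H x l) (y - x) + inner ℝ (gradLam H x l) (k - l))| := by
            simp only [hF, p, q]; congr 1; ring
      _ ≤ M * ‖q - p‖ * ‖q - p‖ := key
      _ = M * ‖q - p‖ ^ 2 := by ring
      _ ≤ _ := by gcongr; exact hnorm x l y k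

/-! ### Controls realizing the Hamiltonian -/

/-- A control that minimizes `l · f(x,a) + h(x,a)` has flux `H_λ(x,l)`: the affine function
`k ↦ k · f(x,a) + h(x,a)` touches the differentiable function `H x` from above at `l`. -/
theorem exists_control
    (hH : P.IsHamiltonian H) (hM : HamiltonianBounds H M) (x l : Vec d) :
    ∃ a ∈ P.B, P.f x a = gradLam H x l ∧ P.h x a = H x l - inner ℝ l (gradLam H x l) := by
  obtain ⟨a, ha, hal⟩ := (hH x l).1
  simp only at hal
  have hf : P.f x a = gradLam H x l := by
    have hmin : IsLocalMin (fun k => inner ℝ (P.f x a) k + P.h x a - H x k) l := by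
      refine Filter.Eventually.of_forall fun k => ?_
      have := (hH x k).2 ⟨a, ha, rfl⟩
      simp only [real_inner_comm (P.f x a)] at this hal ⊢
      linarith
    have hder : HasGradientAt (fun k => inner ℝ (P.f x a) k + P.h x a - H x k)
        (P.f x a - gradLam H x l) l := by
      rw [hasGradientAt_iff_hasFDerivAt, map_sub]
      refine HasFDerivAt.sub (HasFDerivAt.add_const _ ?_) (hM.hasGradientAt_lam x l).hasFDerivAt
      exact (InnerProductSpace.toDual ℝ (Vec d) (P.f x a)).hasFDerivAt
    have := hmin.hasFDerivAt_eq_zero hder.hasFDerivAt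
    have h0 : P.f x a - gradLam H x l = 0 := by
      rwa [LinearIsometryEquiv.map_eq_zero_iff] at this
    exact sub_eq_zero.1 h0
  exact ⟨a, ha, hf, by rw [← hf]; linarith⟩

theorem hamiltonian_le
    (hH : P.IsHamiltonian H) (x l : Vec d) {a : Vec m} (ha : a ∈ P.B) :
    H x l ≤ inner ℝ l (P.f x a) + P.h x a :=
  (hH x l).2 ⟨a, ha, rfl⟩

theorem le_supergradient
    (hH : P.IsHamiltonian H) (hM : HamiltonianBounds H M) (x l k : Vec d) :
    H x k ≤ H x l + inner ℝ (gradLam H x l) (k - l) := by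
  obtain ⟨a, ha, hf, hh⟩ := exists_control hH hM x l
  have := hamiltonian_le hH x k ha
  rw [hf, hh] at this
  rw [inner_sub_right, real_inner_comm k, real_inner_comm l]
  linarith

/-- The flux is bounded by the Lipschitz constant of `H` in `λ`: along the ray `λ = -s f(x,a)` the
inequality `H(x,λ) ≤ λ · f(x,a) + h(x,a)` would fail for large `s` otherwise. -/
theorem norm_flux_le
    (hH : P.IsHamiltonian H) (hM : HamiltonianBounds H M) (x : Vec d) {a : Vec m}
    (ha : a ∈ P.B) : ‖P.f x a‖ ≤ M := by
  by_contra hc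
  push Not at hc
  have hpos : 0 < ‖P.f x a‖ * (‖P.f x a‖ - M) :=
    mul_pos (hM.nonneg.trans_lt hc) (sub_pos.2 hc)
  obtain ⟨s, hs⟩ := exists_nat_gt ((P.h x a - H x 0) / (‖P.f x a‖ * (‖P.f x a‖ - M)))
  rw [div_lt_iff₀ hpos] at hs
  have h1 := hamiltonian_le hH x (-((s : ℝ) • P.f x a)) ha
  have h2 := (abs_le.1 (hM.abs_sub_le x 0 x (-((s : ℝ) • P.f x a)))).1
  rw [inner_neg_left, real_inner_smul_left, real_inner_self_eq_norm_sq] at h1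
  simp only [sub_self, norm_zero, zero_add, sub_zero, norm_neg, norm_smul, Real.norm_natCast] at h2
  nlinarith

/-! ### Admissible paths -/

theorem ControlProblem.Admissible.apply_initial {x : Vec d} {t : ℝ} {X : ℝ → Vec d}
    {α : ℝ → Vec m} (h : P.Admissible x t X α) (ht : t ≤ P.T) : X t = x := by
  simpa using h.state_eq t ⟨le_rfl, ht⟩

theorem ControlProblem.Admissible.sub_eq_integral {x : Vec d} {t : ℝ} {X : ℝ → Vec d}
    {α : ℝ → Vec m} (h : P.Admissible x t X α) {r s : ℝ} (hr : r ∈ Icc t P.T)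
    (hs : s ∈ Icc t P.T) : X s - X r = ∫ q in r..s, P.f (X q) (α q) := by
  have hint : ∀ q ∈ Icc t P.T,
      IntervalIntegrable (fun q => P.f (X q) (α q)) volume t q := fun q hq =>
    h.flux_integrable.mono_set (by
      rw [uIcc_of_le hq.1, uIcc_of_le (hq.1.trans hq.2)]; exact Icc_subset_Icc_right hq.2)
  rw [h.state_eq s hs, h.state_eq r hr, add_sub_add_left_eq_sub]
  exact intervalIntegral.integral_interval_sub_left (hint s hs) (hint r hr)

theorem ControlProblem.Admissible.norm_sub_le (hH : P.IsHamiltonian H)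
    (hM : HamiltonianBounds H M) {x : Vec d} {t : ℝ} {X : ℝ → Vec d}
    {α : ℝ → Vec m} (h : P.Admissible x t X α) {r s : ℝ} (hr : r ∈ Icc t P.T)
    (hs : s ∈ Icc t P.T) : ‖X s - X r‖ ≤ M * |s - r| := by
  rw [h.sub_eq_integral hr hs]
  refine intervalIntegral.norm_integral_le_of_norm_le_const fun q hq => ?_
  exact norm_flux_le hH hM _ (h.control_mem q (uIcc_subset_Icc hr hs (uIoc_subset_uIcc hq)))

/-- The tail of an admissible pair is admissible. -/
theorem ControlProblem.Admissible.tail {x : Vec d} {t : ℝ} {X : ℝ → Vec d}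
    {α : ℝ → Vec m} (h : P.Admissible x t X α) {τ : ℝ} (hτ : τ ∈ Icc t P.T) :
    P.Admissible (X τ) τ X α where
  control_mem s hs := h.control_mem s ⟨hτ.1.trans hs.1, hs.2⟩
  flux_integrable := h.flux_integrable.mono_set (by
    rw [uIcc_of_le hτ.2, uIcc_of_le (hτ.1.trans hτ.2)]; exact Icc_subset_Icc_left hτ.1)
  cost_integrable := h.cost_integrable.mono_set (by
    rw [uIcc_of_le hτ.2, uIcc_of_le (hτ.1.trans hτ.2)]; exact Icc_subset_Icc_left hτ.1)
  state_eq s hs := by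
    rw [← h.sub_eq_integral hτ ⟨hτ.1.trans hs.1, hs.2⟩]; abel

theorem ControlProblem.Admissible.cost_eq {x : Vec d} {t : ℝ} {X : ℝ → Vec d}
    {α : ℝ → Vec m} (h : P.Admissible x t X α) {τ : ℝ} (hτ : τ ∈ Icc t P.T) :
    P.cost t X α = (∫ s in t..τ, P.h (X s) (α s)) + P.cost τ X α := by
  have h1 : IntervalIntegrable (fun s => P.h (X s) (α s)) volume t τ :=
    h.cost_integrable.mono_set (by
      rw [uIcc_of_le hτ.1, uIcc_of_le (hτ.1.trans hτ.2)]; exact Icc_subset_Icc_right hτ.2)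
  rw [ControlProblem.cost, ControlProblem.cost, ← add_assoc,
    intervalIntegral.integral_add_adjacent_intervals h1 (h.tail hτ).cost_integrable]

/-- Following `(X, α)` up to time `τ` and `(Y, γ)` afterwards is admissible, and the costs add. -/
theorem ControlProblem.Admissible.concat {x : Vec d} {t τ : ℝ} {X Y : ℝ → Vec d}
    {α γ : ℝ → Vec m} (h : P.Admissible x t X α) (hτ : τ ∈ Icc t P.T)
    (h' : P.Admissible (X τ) τ Y γ) :
    ∃ (Z : ℝ → Vec d) (δ : ℝ → Vec m), P.Admissible x t Z δ ∧
      P.cost t Z δ = (∫ s in t..τ, P.h (X s) (α s)) + P.cost τ Y γ := by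
  classical
  set Z : ℝ → Vec d := fun s => if s ≤ τ then X s else Y s with hZ
  set δ : ℝ → Vec m := fun s => if s ≤ τ then α s else γ s with hδ
  have hleft : ∀ s, s ≤ τ → Z s = X s ∧ δ s = α s := fun s hs => by simp [hZ, hδ, hs]
  have hright : ∀ s, τ < s → Z s = Y s ∧ δ s = γ s := fun s hs => by
    simp [hZ, hδ, not_le.2 hs]
  have hsub : uIcc t τ ⊆ uIcc t P.T := by
    rw [uIcc_of_le hτ.1, uIcc_of_le (hτ.1.trans hτ.2)]; exact Icc_subset_Icc_right hτ.2
  -- any running quantity agrees with that of the first pair before `τ`, of the second after `τ`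
  have key1 : ∀ {E : Type} (F : Vec d → Vec m → E), ∀ s ≤ τ, t ≤ s →
      EqOn (fun q => F (X q) (α q)) (fun q => F (Z q) (δ q)) (Ι t s) := by
    intro E F s hs hts q hq
    rw [uIoc_of_le hts] at hq
    simp only [hleft q (hq.2.trans hs)]
  have key2 : ∀ {E : Type} (F : Vec d → Vec m → E), ∀ s, τ ≤ s →
      EqOn (fun q => F (Y q) (γ q)) (fun q => F (Z q) (δ q)) (Ι τ s) := by
    intro E F s hs q hq
    rw [uIoc_of_le hs] at hq
    simp only [hright q hq.1]
  have hf1 := (h.flux_integrable.mono_set hsub).congr (key1 P.f τ le_rfl hτ.1)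
  have hf2 := h'.flux_integrable.congr (key2 P.f P.T hτ.2)
  have hc1 := (h.cost_integrable.mono_set hsub).congr (key1 P.h τ le_rfl hτ.1)
  have hc2 := h'.cost_integrable.congr (key2 P.h P.T hτ.2)
  have hint : ∀ {E : Type} [NormedAddCommGroup E] [NormedSpace ℝ E] (a b : ℝ) (φ ψ : ℝ → E),
      EqOn φ ψ (Ι a b) → ∫ q in a..b, φ q = ∫ q in a..b, ψ q := fun a b φ ψ hφ =>
    intervalIntegral.integral_congr_ae (Eventually.of_forall fun q hq => hφ hq)
  refine ⟨Z, δ, ⟨fun s hs => ?_, hf1.trans hf2, fun s hs => ?_, hc1.trans hc2⟩, ?_⟩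
  · rcases le_or_gt s τ with hsτ | hsτ
    · rw [(hleft s hsτ).2]; exact h.control_mem s hs
    · rw [(hright s hsτ).2]; exact h'.control_mem s ⟨hsτ.le, hs.2⟩
  · rcases le_or_gt s τ with hsτ | hsτ
    · rw [(hleft s hsτ).1, h.state_eq s hs, hint _ _ _ _ (key1 P.f s hsτ hs.1)]
    · have hf3 : IntervalIntegrable (fun q => P.f (Z q) (δ q)) volume τ s :=
        hf2.mono_set (by
          rw [uIcc_of_le hsτ.le, uIcc_of_le hτ.2]; exact Icc_subset_Icc_right hs.2)
      rw [(hright s hsτ).1, h'.state_eq s ⟨hsτ.le, hs.2⟩, h.state_eq τ hτ,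
        ← intervalIntegral.integral_add_adjacent_intervals hf1 hf3,
        hint _ _ _ _ (key1 P.f τ le_rfl hτ.1), hint _ _ _ _ (key2 P.f s hsτ.le), add_assoc]
  · have hend : Z P.T = Y P.T := by
      rcases hτ.2.lt_or_eq with hlt | heq
      · exact (hright _ hlt).1
      · rw [(hleft P.T heq.ge).1, ← heq, h'.apply_initial hτ.2]
    rw [ControlProblem.cost, ControlProblem.cost, hend,
      ← intervalIntegral.integral_add_adjacent_intervals hc1 hc2,
      ← hint _ _ _ _ (key1 P.h τ le_rfl hτ.1), ← hint _ _ _ _ (key2 P.h P.T hτ.2), add_assoc]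

theorem ControlProblem.Admissible.integral_cost_add_inner {x : Vec d} {t : ℝ} {X : ℝ → Vec d}
    {α : ℝ → Vec m} (h : P.Admissible x t X α) {τ : ℝ} (hτ : τ ∈ Icc t P.T) (p : Vec d) :
    IntervalIntegrable (fun s => P.h (X s) (α s) + inner ℝ p (P.f (X s) (α s))) volume t τ ∧
    ∫ s in t..τ, (P.h (X s) (α s) + inner ℝ p (P.f (X s) (α s)))
      = (∫ s in t..τ, P.h (X s) (α s)) + inner ℝ p (X τ - x) := by
  have hsub : uIcc t τ ⊆ uIcc t P.T := by
    rw [uIcc_of_le hτ.1, uIcc_of_le (hτ.1.trans hτ.2)]; exact Icc_subset_Icc_right hτ.2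
  have hf := h.flux_integrable.mono_set hsub
  have hh := h.cost_integrable.mono_set hsub
  have ht : t ∈ Icc t P.T := ⟨le_rfl, hτ.1.trans hτ.2⟩
  have hfi : IntervalIntegrable (fun s => inner ℝ p (P.f (X s) (α s))) volume t τ :=
    ⟨(innerSL ℝ p).integrable_comp hf.1, (innerSL ℝ p).integrable_comp hf.2⟩
  have hI := (innerSL ℝ p).intervalIntegral_comp_comm hf
  rw [← h.sub_eq_integral ht hτ, h.apply_initial ht.2] at hI
  simp only [innerSL_apply_apply] at hI
  exact ⟨hh.add hfi, by rw [intervalIntegral.integral_add hh hfi, hI]⟩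

/-- Along an admissible path the Hamiltonian at a fixed dual variable varies slowly, since the path
is Lipschitz. -/
theorem ControlProblem.Admissible.abs_hamiltonian_sub_le (hH : P.IsHamiltonian H)
    (hM : HamiltonianBounds H M) {x : Vec d} {t : ℝ} {X : ℝ → Vec d}
    {α : ℝ → Vec m} (h : P.Admissible x t X α) {s τ : ℝ} (hs : s ∈ Icc t τ) (hτ : τ ≤ P.T)
    (p : Vec d) : |H (X s) p - H x p| ≤ M ^ 2 * (τ - t) := by
  have hs' : s ∈ Icc t P.T := ⟨hs.1, hs.2.trans hτ⟩
  have ht : t ∈ Icc t P.T := ⟨le_rfl, hs'.1.trans hs'.2⟩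
  have h2 := hM.abs_sub_le x p (X s) p
  have h3 := h.norm_sub_le hH hM ht hs'
  rw [h.apply_initial ht.2, abs_of_nonneg (sub_nonneg.2 hs.1)] at h3
  have h4 : ‖X s - x‖ ≤ M * (τ - t) :=
    h3.trans (mul_le_mul_of_nonneg_left (by linarith [hs.2]) hM.nonneg)
  have h5 := mul_le_mul_of_nonneg_left h4 hM.nonneg
  simp only [sub_self, norm_zero, add_zero] at h2
  linarith

/-- The running cost is bounded below through `h(X,α) ≥ H(X,p) - p · f(X,α)`. -/
theorem ControlProblem.Admissible.integral_lower (hH : P.IsHamiltonian H)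
    (hM : HamiltonianBounds H M) {x : Vec d} {t : ℝ} {X : ℝ → Vec d}
    {α : ℝ → Vec m} (h : P.Admissible x t X α) {τ : ℝ} (hτ : τ ∈ Icc t P.T) (p : Vec d) :
    (τ - t) * H x p - M ^ 2 * (τ - t) ^ 2 - inner ℝ p (X τ - x)
      ≤ ∫ s in t..τ, P.h (X s) (α s) := by
  obtain ⟨hi, he⟩ := h.integral_cost_add_inner hτ p
  have hmono := intervalIntegral.integral_mono_on hτ.1
    (intervalIntegrable_const (c := H x p - M ^ 2 * (τ - t))) hi (fun s hs => ?_)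
  · rw [he, intervalIntegral.integral_const, smul_eq_mul] at hmono
    linarith
  · have h1 := hamiltonian_le hH (X s) p (h.control_mem s ⟨hs.1, hs.2.trans hτ.2⟩)
    have h2 := (abs_le.1 (h.abs_hamiltonian_sub_le hH hM hs hτ.2 p)).1
    linarith

theorem ControlProblem.Admissible.integral_upper (hH : P.IsHamiltonian H)
    (hM : HamiltonianBounds H M) {x : Vec d} {t : ℝ} {X : ℝ → Vec d}
    {α : ℝ → Vec m} (h : P.Admissible x t X α) {τ : ℝ} (hτ : τ ∈ Icc t P.T) (p : Vec d)
    (hfb : ∀ s, P.h (X s) (α s) = H (X s) p - inner ℝ p (P.f (X s) (α s))) :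
    ∫ s in t..τ, P.h (X s) (α s)
      ≤ (τ - t) * H x p + M ^ 2 * (τ - t) ^ 2 - inner ℝ p (X τ - x) := by
  obtain ⟨hi, he⟩ := h.integral_cost_add_inner hτ p
  have hmono := intervalIntegral.integral_mono_on hτ.1 hi
    (intervalIntegrable_const (c := H x p + M ^ 2 * (τ - t))) (fun s hs => ?_)
  · rw [he, intervalIntegral.integral_const, smul_eq_mul] at hmono
    linarith
  · have h2 := (abs_le.1 (h.abs_hamiltonian_sub_le hH hM hs hτ.2 p)).2
    linarith [hfb s]

/-- For every constant `p` the feedback law that realizes `H(X,p)` produces an admissible path,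
the solution of `X' = H_λ(X,p)`. The field is bounded and Lipschitz, so the Picard-Lindelöf
theorem applies on the whole of `[t,T]`. -/
theorem exists_feedback (hH : P.IsHamiltonian H) (hM : HamiltonianBounds H M) (p x : Vec d)
    {t : ℝ} (ht : t ≤ P.T) : ∃ (X : ℝ → Vec d) (α : ℝ → Vec m), P.Admissible x t X α ∧
      ∀ s, P.h (X s) (α s) = H (X s) p - inner ℝ p (P.f (X s) (α s)) := by
  obtain ⟨K, rfl⟩ : ∃ K : ℝ≥0, (K : ℝ) = M := ⟨⟨M, hM.nonneg⟩, rfl⟩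
  have hlip : LipschitzWith K fun y => gradLam H y p :=
    LipschitzWith.of_dist_le_mul fun y z => by
      simpa [dist_eq_norm] using hM.norm_gradLam_sub_le y z p
  have hPL : IsPicardLindelof (fun _ y => gradLam H y p) (tmin := t) (tmax := P.T)
      ⟨t, le_rfl, ht⟩ x (K * (P.T - t).toNNReal) 0 K K := by
    refine IsPicardLindelof.of_time_independent (fun y _ => hM.norm_gradLam_le y p)
      hlip.lipschitzOnWith ?_
    simp [ht]
  obtain ⟨X, hX0, hX⟩ := hPL.exists_eq_forall_mem_Icc_hasDerivWithinAt₀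
  choose a haB haf hah using fun y => exists_control hH hM y p
  have hXc : ContinuousOn X (Icc t P.T) := fun s hs => (hX s hs).continuousWithinAt
  have hfc : ContinuousOn (fun s => gradLam H (X s) p) (uIcc t P.T) := by
    rw [uIcc_of_le ht]; exact hlip.continuous.comp_continuousOn hXc
  have hHc : Continuous fun y => H y p :=
    (LipschitzWith.of_dist_le_mul (K := K) fun y z => by
      simpa [dist_eq_norm] using hM.abs_sub_le z p y p).continuous
  have hhc : ContinuousOn (fun s => H (X s) p - inner ℝ p (gradLam H (X s) p))
      (uIcc t P.T) := by
    refine ContinuousOn.sub ?_ (continuousOn_const.inner hfc)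
    rw [uIcc_of_le ht]; exact hHc.comp_continuousOn hXc
  refine ⟨X, fun s => a (X s), ⟨fun s _ => haB _, ?_, fun s hs => ?_, ?_⟩, fun s => ?_⟩
  · simp only [haf]; exact hfc.intervalIntegrable
  · have hsub : uIcc t s ⊆ uIcc t P.T := by
      rw [uIcc_of_le hs.1, uIcc_of_le ht]; exact Icc_subset_Icc_right hs.2
    simp only [haf]
    rw [intervalIntegral.integral_eq_sub_of_hasDeriv_right_of_le hs.1
      (hXc.mono (Icc_subset_Icc_right hs.2)) (fun r hr => ?_)
      (hfc.mono hsub).intervalIntegrable, hX0, add_sub_cancel]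
    exact ((hX r ⟨hr.1.le, hr.2.le.trans hs.2⟩).hasDerivAt
      (Icc_mem_nhds hr.1 (hr.2.trans_le hs.2))).hasDerivWithinAt
  · simp only [hah]; exact hhc.intervalIntegrable
  · rw [hah, haf]

/-! ### Dynamic programming -/

theorem ControlProblem.value_lt_iff {x : Vec d} {t : ℝ} {c : EReal} : P.value x t < c ↔
    ∃ X α, P.Admissible x t X α ∧ ((P.cost t X α : ℝ) : EReal) < c := by
  simp [ControlProblem.value, iInf_lt_iff]

/-- Upper dynamic programming bound: steering by the feedback law for `p` until time `τ` costs at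
most the linearization of the running cost, up to a quadratic error. -/
theorem exists_value_lt (hH : P.IsHamiltonian H) (hM : HamiltonianBounds H M) (x p : Vec d)
    {t τ : ℝ} (htτ : t ≤ τ) (hτ : τ ≤ P.T) :
    ∃ y : Vec d, ‖y - x‖ ≤ M * (τ - t) ∧ ∀ b : ℝ, P.value y τ < b →
      P.value x t <
        (((τ - t) * H x p + M ^ 2 * (τ - t) ^ 2 - inner ℝ p (y - x) + b : ℝ) : EReal) := by
  obtain ⟨X, α, hX, hfb⟩ := exists_feedback hH hM p x (htτ.trans hτ)
  have ht' : t ∈ Icc t P.T := ⟨le_rfl, htτ.trans hτ⟩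
  refine ⟨X τ, ?_, fun b hb => ?_⟩
  · have := hX.norm_sub_le hH hM ht' ⟨htτ, hτ⟩
    rwa [hX.apply_initial ht'.2, abs_of_nonneg (sub_nonneg.2 htτ)] at this
  · obtain ⟨Y, γ, hY, hlt⟩ := ControlProblem.value_lt_iff.1 hb
    obtain ⟨Z, δ, hZ, hcost⟩ := hX.concat ⟨htτ, hτ⟩ hY
    refine ControlProblem.value_lt_iff.2 ⟨Z, δ, hZ, ?_⟩
    rw [EReal.coe_lt_coe_iff] at hlt ⊢
    linarith [hX.integral_upper hH hM ⟨htτ, hτ⟩ p hfb]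

/-- Lower dynamic programming bound: every path pays at least the linearization of the running
cost, up to a quadratic error, plus the value at the point where it is at time `τ`. -/
theorem exists_lt_of_value_lt (hH : P.IsHamiltonian H) (hM : HamiltonianBounds H M)
    {x : Vec d} {t τ b : ℝ} (htτ : t ≤ τ) (hτ : τ ≤ P.T) (hb : P.value x t < b) (p : Vec d) :
    ∃ y : Vec d, ‖y - x‖ ≤ M * (τ - t) ∧ P.value y τ <
      ((b - ((τ - t) * H x p - M ^ 2 * (τ - t) ^ 2 - inner ℝ p (y - x)) : ℝ) : EReal) := by
  obtain ⟨X, α, hX, hlt⟩ := ControlProblem.value_lt_iff.1 hb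
  have ht' : t ∈ Icc t P.T := ⟨le_rfl, htτ.trans hτ⟩
  refine ⟨X τ, ?_, ControlProblem.value_lt_iff.2 ⟨X, α, hX.tail ⟨htτ, hτ⟩, ?_⟩⟩
  · have := hX.norm_sub_le hH hM ht' ⟨htτ, hτ⟩
    rwa [hX.apply_initial ht'.2, abs_of_nonneg (sub_nonneg.2 htτ)] at this
  · rw [EReal.coe_lt_coe_iff] at hlt ⊢
    rw [hX.cost_eq ⟨htτ, hτ⟩] at hlt
    linarith [hX.integral_lower hH hM ⟨htτ, hτ⟩ p]

theorem value_terminal (hH : P.IsHamiltonian H) (hM : HamiltonianBounds H M) (x : Vec d) :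
    P.value x P.T = (P.g x : EReal) := by
  have hcost : ∀ X α, P.Admissible x P.T X α → P.cost P.T X α = P.g x := fun X α hX => by
    rw [ControlProblem.cost, hX.apply_initial le_rfl, intervalIntegral.integral_same, zero_add]
  refine le_antisymm ?_ (le_iInf fun X => le_iInf fun α => le_iInf fun hX => ?_)
  · obtain ⟨X, α, hX, -⟩ := exists_feedback hH hM 0 x (le_refl P.T)
    rw [ControlProblem.value, ← hcost X α hX]
    exact iInf_le_of_le X (iInf_le_of_le α (iInf_le _ hX))
  · rw [hcost X α hX]

/-! ### The Hamilton-Jacobi-Bellman equation -/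

theorem norm_prod_sub_le {x y : Vec d} {t τ : ℝ} (hM0 : 0 ≤ M) (hτ : t < τ)
    (hy : ‖y - x‖ ≤ M * (τ - t)) : ‖(y, τ) - (x, t)‖ ≤ (M + 1) * (τ - t) := by
  have hpos : 0 < τ - t := sub_pos.2 hτ
  rw [Prod.mk_sub_mk, Prod.norm_mk, Real.norm_eq_abs, abs_of_pos hpos]
  exact max_le (by nlinarith) (by nlinarith)

/-- A property that holds near `(x,t)` holds on the cone of points that can be reached from
`(x,t)` with speed at most `M`, for short times. -/
theorem eventually_forall_cone {p : Vec d × ℝ → Prop} {x : Vec d} {t : ℝ}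
    (h : ∀ᶠ q in 𝓝 (x, t), p q) (hM0 : 0 ≤ M) :
    ∀ᶠ τ in 𝓝[>] t, ∀ y : Vec d, ‖y - x‖ ≤ M * (τ - t) → p (y, τ) := by
  obtain ⟨r, hr, hp⟩ := Metric.eventually_nhds_iff.1 h
  have hlt : t < t + r / (M + 1) := by
    have : 0 < r / (M + 1) := by positivity
    linarith
  filter_upwards [Ioo_mem_nhdsGT hlt] with τ hτ y hy
  refine hp ?_
  rw [dist_eq_norm]
  refine (norm_prod_sub_le hM0 hτ.1 hy).trans_lt ?_
  have h2 : τ - t < r / (M + 1) := by linarith [hτ.2]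
  rw [lt_div_iff₀ (by positivity)] at h2
  linarith

/-- Where the value function is differentiable it solves `u_t + H(x,u_x) = 0`. -/
theorem hamiltonJacobi (hH : P.IsHamiltonian H) (hM : HamiltonianBounds H M)
    {v : Vec d × ℝ → ℝ} {x p : Vec d} {t : ℝ} (ht : t < P.T) {A : Vec d × ℝ →L[ℝ] ℝ}
    (hv : HasFDerivAt v A (x, t)) (hp : ∀ w, A (w, 0) = inner ℝ p w)
    (huv : ∀ᶠ q in 𝓝 (x, t), P.value q.1 q.2 = (v q : EReal)) :
    A (0, 1) + H x p = 0 := by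
  have hM0 := hM.nonneg
  have hx : P.value x t = (v (x, t) : EReal) := huv.self_of_nhds
  suffices h : ∀ ε : ℝ, 0 < ε → |A (0, 1) + H x p| ≤ 3 * ε by
    by_contra hne
    have hpos := abs_pos.2 hne
    linarith [h (|A (0, 1) + H x p| / 6) (by positivity)]
  intro ε hε
  have hder := hv.isLittleO.def (c := ε / (M + 1)) (by positivity)
  have hsmall : ∀ᶠ τ in 𝓝[>] t, τ < t + ε / (M ^ 2 + 1) := by
    have : 0 < ε / (M ^ 2 + 1) := by positivity
    exact eventually_nhdsWithin_of_eventually_nhds (eventually_lt_nhds (by linarith))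
  obtain ⟨τ, hcd, hcv, hτt, hτT, hτs⟩ := ((eventually_forall_cone hder hM0).and
    ((eventually_forall_cone huv hM0).and ((eventually_mem_nhdsWithin (s := Ioi t)).and
      ((eventually_nhdsWithin_of_eventually_nhds (eventually_le_nhds ht)).and hsmall)))).exists
  set δ := τ - t with hδ
  have hδ0 : 0 < δ := sub_pos.2 hτt
  have hMδ : M ^ 2 * δ ≤ ε := by
    have h1 : δ < ε / (M ^ 2 + 1) := by rw [hδ]; linarith
    rw [lt_div_iff₀ (by positivity)] at h1
    nlinarith
  have hMδ2 : M ^ 2 * δ ^ 2 ≤ ε * δ := by nlinarith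
  -- first-order expansion of `v` on the cone
  have hexp : ∀ y, ‖y - x‖ ≤ M * δ →
      |v (y, τ) - v (x, t) - (inner ℝ p (y - x) + δ * A (0, 1))| ≤ ε * δ := by
    intro y hy
    have h1 := hcd y hy
    have h2 : A ((y, τ) - (x, t)) = inner ℝ p (y - x) + δ * A (0, 1) := by
      rw [← hp, ← smul_eq_mul, ← map_smul, ← map_add]
      simp [hδ]
    rw [h2, Real.norm_eq_abs] at h1
    refine h1.trans ?_
    calc ε / (M + 1) * ‖(y, τ) - (x, t)‖ ≤ ε / (M + 1) * ((M + 1) * δ) := by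
          gcongr; exact norm_prod_sub_le hM0 hτt hy
      _ = ε * δ := by field_simp
  rw [abs_le]
  constructor
  · obtain ⟨y, hy, hyb⟩ := exists_value_lt hH hM x p (le_of_lt hτt) hτT
    have h1 := hyb (v (y, τ) + ε * δ) (by
      rw [hcv y hy, EReal.coe_lt_coe_iff]; linarith [mul_pos hε hδ0])
    rw [hx, EReal.coe_lt_coe_iff, ← hδ] at h1
    have h2 := (abs_le.1 (hexp y hy)).2
    have h3 : 0 < δ * (A (0, 1) + H x p + 3 * ε) := by linarith
    linarith [pos_of_mul_pos_right h3 hδ0.le]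
  · obtain ⟨y, hy, hyb⟩ := exists_lt_of_value_lt hH hM (b := v (x, t) + ε * δ) (le_of_lt hτt) hτT
      (by rw [hx, EReal.coe_lt_coe_iff]; linarith [mul_pos hε hδ0]) p
    rw [hcv y hy, EReal.coe_lt_coe_iff, ← hδ] at hyb
    have h2 := (abs_le.1 (hexp y hy)).1
    have h3 : 0 < δ * (3 * ε - (A (0, 1) + H x p)) := by linarith
    linarith [pos_of_mul_pos_right h3 hδ0.le]

/-! ### Continuity of the value function at the terminal and at the initial time -/

/-- A semiconcave function that is bounded below near `x` is continuous at `x`: semiconcavity along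
the radii of the unit ball around `x` gives lower semicontinuity, and along the diameters, upper
semicontinuity. -/
theorem continuousAt_of_semiconcave {φ : Vec d → ℝ} {x : Vec d} {c : ℝ}
    (hφ : Semiconcave (Metric.closedBall x 1) φ) (hc : ∀ y ∈ Metric.closedBall x 1, c ≤ φ y) :
    ContinuousAt φ x := by
  obtain ⟨ω, hω0, hωm, -, -, hsc⟩ := hφ
  have hxm : x ∈ Metric.closedBall x 1 := Metric.mem_closedBall_self zero_le_one
  have hcx := hc x hxm
  set K : ℝ := 2 * (φ x - c) + 2 * ω 2 with hK
  have hω2 : 0 ≤ ω 2 := hω0 2 (by norm_num)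
  have hbound : ∀ y, ‖y - x‖ ≤ 1 → |φ y - φ x| ≤ K * ‖y - x‖ := by
    intro y hy
    rcases eq_or_ne y x with rfl | hne
    · simp
    set r := ‖y - x‖ with hr
    have hr0 : 0 < r := norm_pos_iff.2 (sub_ne_zero.2 hne)
    set e : Vec d := r⁻¹ • (y - x) with he
    have hre : r • e = y - x := by rw [he, smul_smul, mul_inv_cancel₀ hr0.ne', one_smul]
    have hen : ‖e‖ = 1 := by
      rw [he, norm_smul, norm_inv, Real.norm_eq_abs, abs_of_pos hr0, ← hr,
        inv_mul_cancel₀ hr0.ne']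
    have hym : y ∈ Metric.closedBall x 1 := by rwa [Metric.mem_closedBall, dist_eq_norm]
    have hpm : x + e ∈ Metric.closedBall x 1 := by simp [hen]
    have hmm : x - e ∈ Metric.closedBall x 1 := by simp [hen]
    have hseg : ∀ {a b : Vec d}, a ∈ Metric.closedBall x 1 → b ∈ Metric.closedBall x 1 →
        segment ℝ a b ⊆ Metric.closedBall x 1 := fun ha hb =>
      (convex_closedBall x 1).segment_subset ha hb
    have hyx : y = x + r • e := by rw [hre]; abel
    rw [abs_le]
    constructor
    · have h := hsc _ hpm _ hxm (hseg hpm hxm) r hr0.le hy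
      have h1 : r • (x + e) + (1 - r) • x = y := by rw [hyx]; module
      have h2 : ‖x + e - x‖ = 1 := by simp [hen]
      have h3 : ω 1 ≤ ω 2 := hωm (by simp) (by simp) (by norm_num)
      have h4 := hω0 1 zero_le_one
      rw [h1, h2] at h
      have h5 := hc _ hpm
      have h6 : r * (1 - r) * 1 * ω 1 ≤ r * ω 2 := by
        have : r * (1 - r) * ω 1 ≤ r * ω 1 := by nlinarith [mul_nonneg (sq_nonneg r) h4]
        nlinarith
      rw [hK]
      nlinarith
    · -- `x` divides the segment from `y` to `x - e` in the ratio `r : 1`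
      have hw0 : (0 : ℝ) ≤ 1 / (1 + r) := by positivity
      have hw1 : 1 / (1 + r) ≤ 1 := by rw [div_le_one (by positivity)]; linarith
      have h := hsc _ hym _ hmm (hseg hym hmm) _ hw0 hw1
      have h1 : (1 / (1 + r)) • y + (1 - 1 / (1 + r)) • (x - e) = x := by
        have : (1 - 1 / (1 + r)) = (1 / (1 + r)) * r := by field_simp; ring
        rw [this, hyx]
        have h1 : (1 / (1 + r)) + (1 / (1 + r)) * r = 1 := by field_simp
        calc _ = ((1 / (1 + r)) + (1 / (1 + r)) * r) • x := by module
          _ = x := by rw [h1, one_smul]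
      have h2 : ‖y - (x - e)‖ = 1 + r := by
        have : y - (x - e) = (1 + r) • e := by rw [hyx]; module
        rw [this, norm_smul, hen, mul_one, Real.norm_eq_abs, abs_of_pos (by positivity)]
      have h3 : ω (1 + r) ≤ ω 2 := hωm (by simp; positivity) (by simp) (by linarith)
      have h4 := hω0 (1 + r) (by positivity)
      rw [h1, h2] at h
      have h5 := hc _ hmm
      have h7 : φ y + r * φ (x - e) - (1 + r) * φ x ≤ r * ω (1 + r) := by
        have h8 := mul_le_mul_of_nonneg_left h (by positivity : (0 : ℝ) ≤ 1 + r)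
        have e1 : (1 + r) * (1 / (1 + r) * φ y + (1 - 1 / (1 + r)) * φ (x - e) - φ x)
            = φ y + r * φ (x - e) - (1 + r) * φ x := by field_simp; ring
        have e2 : (1 + r) * (1 / (1 + r) * (1 - 1 / (1 + r)) * (1 + r) * ω (1 + r))
            = r * ω (1 + r) := by field_simp; ring
        rwa [e1, e2] at h8
      have h9 : r * ω (1 + r) ≤ r * ω 2 := mul_le_mul_of_nonneg_left h3 hr0.le
      rw [hK]
      nlinarith
  have hlim : Tendsto (fun y => K * ‖y - x‖) (𝓝 x) (𝓝 0) := by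
    have : Continuous fun y : Vec d => K * ‖y - x‖ := by fun_prop
    simpa using this.tendsto x
  rw [ContinuousAt, tendsto_iff_norm_sub_tendsto_zero]
  refine squeeze_zero' (Eventually.of_forall fun y => norm_nonneg _) ?_ hlim
  filter_upwards [Metric.closedBall_mem_nhds x one_pos] with y hy
  exact hbound y (by rwa [Metric.mem_closedBall, dist_eq_norm] at hy)

theorem StandingConditions.continuous_g {g : Vec d → ℝ} (h : StandingConditions g H) :
    Continuous g := by
  obtain ⟨k, hk⟩ := h.g_lower
  refine continuous_iff_continuousAt.2 fun x => continuousAt_of_semiconcave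
    (h.g_semiconcave _ (isCompact_closedBall x 1)) (c := -|k| * (2 + ‖x‖)) fun y hy => ?_
  have h1 : ‖y‖ ≤ 1 + ‖x‖ := by
    have := norm_le_norm_add_norm_sub x y
    rw [Metric.mem_closedBall, dist_eq_norm] at hy
    rw [norm_sub_rev] at this
    linarith
  have h2 : -|k| * (2 + ‖x‖) ≤ -|k| * (1 + ‖y‖) := by nlinarith [abs_nonneg k]
  have h3 : -|k| * (1 + ‖y‖) ≤ -k * (1 + ‖y‖) := by
    nlinarith [le_abs_self k, norm_nonneg y]
  linarith [hk y]

/-- Joint continuity of the value function at the points of terminal time, for those times `s ≤ T`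
and points at which it is finite. -/
theorem value_continuous_terminal (hH : P.IsHamiltonian H) (hM : HamiltonianBounds H M)
    (hg : Continuous P.g) (x : Vec d) {η : ℝ} (hη : 0 < η) :
    ∃ δ : ℝ, 0 < δ ∧ ∀ (y : Vec d) (s w : ℝ), ‖y - x‖ < δ → P.T - δ < s → s ≤ P.T →
      P.value y s = (w : EReal) → |w - P.g x| < η := by
  have hM0 := hM.nonneg
  obtain ⟨r, hr, hgr⟩ :=
    Metric.continuousAt_iff.1 (hg.continuousAt (x := x)) (η / 3) (by positivity)
  set C := |H x 0| + M + M ^ 2 with hC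
  have hC0 : 0 ≤ C := by positivity
  refine ⟨min 1 (min (r / (M + 1)) (η / (3 * (C + 1)))), by positivity, ?_⟩
  intro y s w hy hs hsT hw
  rw [lt_min_iff, lt_min_iff] at hy
  obtain ⟨hy1, hyr, -⟩ := hy
  set δ := P.T - s with hδ
  have hδ0 : 0 ≤ δ := sub_nonneg.2 hsT
  have hδ' : δ < min 1 (min (r / (M + 1)) (η / (3 * (C + 1)))) := by rw [hδ]; linarith
  rw [lt_min_iff, lt_min_iff] at hδ'
  obtain ⟨hδ1, hδr, hδη⟩ := hδ'
  have hgz : ∀ z : Vec d, ‖z - y‖ ≤ M * δ → |P.g z - P.g x| < η / 3 := by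
    intro z hz
    refine hgr ?_
    rw [dist_eq_norm]
    have h1 : M * δ ≤ M * (r / (M + 1)) := mul_le_mul_of_nonneg_left hδr.le hM0
    have h2 : M * (r / (M + 1)) + r / (M + 1) = r := by field_simp
    linarith [norm_sub_le_norm_sub_add_norm_sub z y x]
  have hHy : |δ * H y 0| + M ^ 2 * δ ^ 2 ≤ C * δ := by
    have h1 := hM.abs_sub_le x 0 y 0
    simp only [sub_self, norm_zero, add_zero] at h1
    have h2 : M * ‖y - x‖ ≤ M := by nlinarith
    have h3 : |H y 0| ≤ |H x 0| + M := by
      have := abs_sub_abs_le_abs_sub (H y 0) (H x 0)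
      linarith
    have h4 : M ^ 2 * δ ^ 2 ≤ M ^ 2 * δ := by
      have : δ ^ 2 ≤ δ := by nlinarith
      exact mul_le_mul_of_nonneg_left this (sq_nonneg M)
    rw [abs_mul, abs_of_nonneg hδ0, hC]
    nlinarith
  have hCδ : C * δ < η / 3 := by
    rw [lt_div_iff₀ (by positivity)] at hδη
    nlinarith
  have hab := abs_le.1 (le_refl |δ * H y 0|)
  rw [abs_lt]
  constructor
  · obtain ⟨z, hz, hlt⟩ := exists_lt_of_value_lt hH hM (b := w + η / 6) hsT le_rfl
      (by rw [hw, EReal.coe_lt_coe_iff]; linarith) 0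
    rw [value_terminal hH hM, EReal.coe_lt_coe_iff, inner_zero_left, ← hδ] at hlt
    linarith [(abs_lt.1 (hgz z hz)).1]
  · obtain ⟨z, hz, hlt⟩ := exists_value_lt hH hM y 0 hsT le_rfl
    have h1 := hlt (P.g z + η / 6)
      (by rw [value_terminal hH hM, EReal.coe_lt_coe_iff]; linarith)
    rw [hw, EReal.coe_lt_coe_iff, inner_zero_left, ← hδ] at h1
    linarith [(abs_lt.1 (hgz z hz)).2]

/-- If the value function is Lipschitz in space on the points that can be reached from `x₀` in
short time, then it is finite at `(x₀,0)` and is attained there with a linear rate. -/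
theorem exists_value_initial (hH : P.IsHamiltonian H) (hM : HamiltonianBounds H M)
    {v : Vec d × ℝ → ℝ} {x₀ : Vec d} {σ L : ℝ} (hσ : 0 < σ) (hσT : σ ≤ P.T) (hL : 0 ≤ L)
    (hval : ∀ s ∈ Ioo 0 σ, ∀ y : Vec d, ‖y - x₀‖ ≤ M * s → P.value y s = (v (y, s) : EReal))
    (hlip : ∀ s ∈ Ioo 0 σ, ∀ y y' : Vec d, ‖y - x₀‖ ≤ M * s → ‖y' - x₀‖ ≤ M * s →
      |v (y, s) - v (y', s)| ≤ L * ‖y - y'‖) :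
    ∃ u₀ : ℝ, P.value x₀ 0 = (u₀ : EReal) ∧ ∃ K : ℝ, ∀ s ∈ Ioo 0 σ, ∀ y : Vec d,
      ‖y - x₀‖ ≤ M * s → |v (y, s) - u₀| ≤ K * s := by
  have hM0 := hM.nonneg
  have hdiff : ∀ s ∈ Ioo 0 σ, ∀ y y' : Vec d, ‖y - x₀‖ ≤ M * s → ‖y' - x₀‖ ≤ M * s →
      |v (y, s) - v (y', s)| ≤ 2 * L * M * s := by
    intro s hs y y' hy hy'
    refine (hlip s hs y y' hy hy').trans ?_
    have h1 : ‖y - y'‖ ≤ M * s + M * s := by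
      refine (norm_sub_le_norm_sub_add_norm_sub y x₀ y').trans (add_le_add hy ?_)
      rwa [norm_sub_rev]
    nlinarith
  set K := |H x₀ 0| + M ^ 2 * σ + 2 * L * M with hK
  have hKs : ∀ s ∈ Ioo 0 σ, |s * H x₀ 0| + M ^ 2 * s ^ 2 + 2 * L * M * s ≤ K * s := by
    intro s hs
    have : M ^ 2 * s ^ 2 ≤ M ^ 2 * (σ * s) :=
      mul_le_mul_of_nonneg_left (by nlinarith [hs.1, hs.2]) (sq_nonneg M)
    rw [abs_mul, abs_of_pos hs.1, hK]
    linarith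
  have hupper : ∀ s ∈ Ioo 0 σ, ∀ y : Vec d, ‖y - x₀‖ ≤ M * s → ∀ κ : ℝ, 0 < κ →
      P.value x₀ 0 < ((v (y, s) + K * s + κ : ℝ) : EReal) := by
    intro s hs y hy κ hκ
    obtain ⟨z, hz, hlt⟩ := exists_value_lt hH hM x₀ 0 hs.1.le (hs.2.le.trans hσT)
    rw [sub_zero] at hz
    have h1 := hlt (v (z, s) + κ) (by rw [hval s hs z hz, EReal.coe_lt_coe_iff]; linarith)
    refine h1.trans_le ?_
    rw [EReal.coe_le_coe_iff, inner_zero_left, sub_zero]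
    linarith [(abs_le.1 (hdiff s hs z y hz hy)).2, le_abs_self (s * H x₀ 0), hKs s hs]
  have hlower : ∀ s ∈ Ioo 0 σ, ∀ y : Vec d, ‖y - x₀‖ ≤ M * s → ∀ b : ℝ,
      P.value x₀ 0 < (b : EReal) → v (y, s) < b + K * s := by
    intro s hs y hy b hb
    obtain ⟨z, hz, hlt⟩ := exists_lt_of_value_lt hH hM hs.1.le (hs.2.le.trans hσT) hb 0
    rw [sub_zero] at hz
    rw [hval s hs z hz, EReal.coe_lt_coe_iff, inner_zero_left, sub_zero] at hlt
    linarith [(abs_le.1 (hdiff s hs z y hz hy)).1, neg_abs_le (s * H x₀ 0), hKs s hs]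
  have hs2 : σ / 2 ∈ Ioo 0 σ := ⟨by linarith, by linarith⟩
  have hx₀ : ‖x₀ - x₀‖ ≤ M * (σ / 2) := by simp; positivity
  have htop : P.value x₀ 0 ≠ ⊤ := (hupper _ hs2 x₀ hx₀ 1 one_pos).ne_top
  have hbot : P.value x₀ 0 ≠ ⊥ := fun hb => by
    have := hlower _ hs2 x₀ hx₀ (v (x₀, σ / 2) - K * (σ / 2) - 1)
      (by rw [hb]; exact EReal.bot_lt_coe _)
    linarith
  refine ⟨(P.value x₀ 0).toReal, (EReal.coe_toReal htop hbot).symm, K, fun s hs y hy => ?_⟩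
  set u₀ := (P.value x₀ 0).toReal with hu₀
  have hu : P.value x₀ 0 = (u₀ : EReal) := (EReal.coe_toReal htop hbot).symm
  rw [abs_le]
  constructor
  · have : u₀ ≤ v (y, s) + K * s := le_of_forall_pos_le_add fun κ hκ => by
      have := hupper s hs y hy κ hκ
      rw [hu, EReal.coe_lt_coe_iff] at this
      exact this.le
    linarith
  · have : v (y, s) ≤ u₀ + K * s := le_of_forall_pos_le_add fun κ hκ => by
      have := hlower s hs y hy (u₀ + κ) (by rw [hu, EReal.coe_lt_coe_iff]; linarith)
      linarith
    linarith

/-! ### The local error of one step -/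

/-- On the open set `Ω` the value function of `P` is the real function `v`, which is twice
differentiable with first and second derivatives bounded by `L`. -/
structure SmoothValueOn (P : ControlProblem d m) (Ω : Set (Vec d × ℝ)) (v : Vec d × ℝ → ℝ)
    (L : ℝ) : Prop where
  isOpen : IsOpen Ω
  nonneg : 0 ≤ L
  value_eq : ∀ q ∈ Ω, P.value q.1 q.2 = (v q : EReal)
  differentiableAt : ∀ q ∈ Ω, DifferentiableAt ℝ v q
  differentiableAt_fderiv : ∀ q ∈ Ω, DifferentiableAt ℝ (fderiv ℝ v) q
  norm_fderiv_le : ∀ q ∈ Ω, ‖fderiv ℝ v q‖ ≤ L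
  norm_fderiv_fderiv_le : ∀ q ∈ Ω, ‖fderiv ℝ (fderiv ℝ v) q‖ ≤ L

theorem EBoundedCk.exists_smoothValueOn {Ω : Set (Vec d × ℝ)} (hΩ : IsOpen Ω)
    (h : EBoundedCk 3 (fun p : Vec d × ℝ => P.value p.1 p.2) Ω) :
    ∃ v L, SmoothValueOn P Ω v L := by
  obtain ⟨v, hv, hb⟩ := h
  obtain ⟨L, hL0, hL⟩ := hb.exists_bound (by norm_num) hΩ
  exact ⟨v, L, hΩ, hL0, hv, fun q hq => (hL q hq).1, fun q hq => (hL q hq).2.1,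
    fun q hq => (hL q hq).2.2.1, fun q hq => (hL q hq).2.2.2⟩

/-- The gradient in the space variable of a function of space and time. -/
noncomputable def spaceGradient (v : Vec d × ℝ → ℝ) (q : Vec d × ℝ) : Vec d :=
  (InnerProductSpace.toDual ℝ (Vec d)).symm
    ((fderiv ℝ v q).comp (ContinuousLinearMap.inl ℝ (Vec d) ℝ))

theorem inner_spaceGradient (v : Vec d × ℝ → ℝ) (q : Vec d × ℝ) (w : Vec d) :
    inner ℝ (spaceGradient v q) w = fderiv ℝ v q (w, 0) := by
  simp [spaceGradient]

theorem norm_spaceGradient_sub_le (v : Vec d × ℝ → ℝ) (q q' : Vec d × ℝ) :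
    ‖spaceGradient v q - spaceGradient v q'‖ ≤ ‖fderiv ℝ v q - fderiv ℝ v q'‖ := by
  refine norm_le_of_abs_inner_le (norm_nonneg _) fun w => ?_
  rw [inner_sub_left, inner_spaceGradient, inner_spaceGradient, ← _root_.sub_apply,
    ← Real.norm_eq_abs]
  refine (ContinuousLinearMap.le_opNorm _ _).trans_eq ?_
  simp [Prod.norm_mk]

theorem SmoothValueOn.eHasGradientAt {Ω : Set (Vec d × ℝ)} {v : Vec d × ℝ → ℝ} {L : ℝ}
    (h : SmoothValueOn P Ω v L) {x : Vec d} {t : ℝ} (hx : (x, t) ∈ Ω) :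
    EHasGradientAt (fun y => P.value y t) (spaceGradient v (x, t)) x := by
  refine ⟨fun y => v (y, t), ?_, ?_⟩
  · have hcont : ContinuousAt (fun y : Vec d => (y, t)) x := by fun_prop
    filter_upwards [hcont (h.isOpen.mem_nhds hx)] with y hy
    exact h.value_eq _ hy
  · rw [hasGradientAt_iff_hasFDerivAt, spaceGradient, LinearIsometryEquiv.apply_symm_apply]
    exact HasFDerivAt.comp (g := v) (f := fun y : Vec d => (y, t)) x
      (h.differentiableAt _ hx).hasFDerivAt (hasFDerivAt_prodMk_left x t)

theorem SmoothValueOn.hamiltonJacobi {Ω : Set (Vec d × ℝ)} {v : Vec d × ℝ → ℝ} {L : ℝ}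
    (h : SmoothValueOn P Ω v L) (hH : P.IsHamiltonian H) (hM : HamiltonianBounds H M)
    {x : Vec d} {t : ℝ} (ht : t < P.T) (hx : (x, t) ∈ Ω) :
    fderiv ℝ v (x, t) (0, 1) = -H x (spaceGradient v (x, t)) := by
  have := SymplecticEuler.hamiltonJacobi hH hM ht (h.differentiableAt _ hx).hasFDerivAt
    (fun w => (inner_spaceGradient v _ w).symm)
    (by filter_upwards [h.isOpen.mem_nhds hx] with q hq using h.value_eq q hq)
  linarith

/-- The local error. Along the straight line with velocity `β = H_λ(x,l)` the derivative of the
value is, by the Hamilton-Jacobi equation, `p · β - H(Y,p)` with `p = u_x`. As `β = H_λ(x,l)`, the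
first-order Taylor expansion of `H` at `(x,l)` leaves no term that is linear in `p - l`. The error
in the dual variable therefore enters only quadratically. -/
theorem SmoothValueOn.abs_local_error_le {Ω : Set (Vec d × ℝ)} {v : Vec d × ℝ → ℝ} {L : ℝ}
    (h : SmoothValueOn P Ω v L) (hH : P.IsHamiltonian H) (hM : HamiltonianBounds H M)
    {x l : Vec d} {a b D K : ℝ} (hab : a < b) (ha : 0 ≤ a) (hb : b ≤ P.T) (hD : b - a ≤ D)
    {U : ℝ → ℝ} (hU : ContinuousOn U (Icc a b))
    (hΩ : ∀ s ∈ Icc a b, s ∈ Ioo 0 P.T → (x + (s - a) • gradLam H x l, s) ∈ Ω)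
    (hUv : ∀ s ∈ Ioo a b, U s = v (x + (s - a) • gradLam H x l, s))
    {s₀ : ℝ} (hs₀ : s₀ ∈ Icc a b) (hs₀T : s₀ ∈ Ioo 0 P.T)
    (hl : ‖spaceGradient v (x + (s₀ - a) • gradLam H x l, s₀) - l‖ ≤ K * D) :
    |(b - a) * (H x l - inner ℝ l (gradLam H x l)) + U b - U a
        - (b - a) ^ 2 * (-inner ℝ (gradLam H x l) (gradX H x l) / 2)|
      ≤ M * (M + K + L * (M + 1)) ^ 2 * D ^ 2 * (b - a) := by
  have hM0 := hM.nonneg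
  have hD0 : 0 ≤ D := (sub_pos.2 hab).le.trans hD
  set β := gradLam H x l with hβ
  have hβM : ‖β‖ ≤ M := hM.norm_gradLam_le x l
  set Y : ℝ → Vec d := fun s => x + (s - a) • β with hY
  set φ := H x l - inner ℝ l β with hφ
  set c := inner ℝ β (gradX H x l) with hc
  have hIoo : ∀ s ∈ Ioo a b, s ∈ Ioo 0 P.T := fun s hs =>
    ⟨ha.trans_lt hs.1, hs.2.trans_le hb⟩
  have hYΩ : ∀ s ∈ Ioo a b, (Y s, s) ∈ Ω := fun s hs =>
    hΩ s (Ioo_subset_Icc_self hs) (hIoo s hs)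
  have hgrad : ∀ s ∈ Ioo a b, ‖spaceGradient v (Y s, s) - l‖ ≤ (K + L * (M + 1)) * D := by
    intro s hs
    have hseg : segment ℝ (Y s₀, s₀) (Y s, s) ⊆ Ω := by
      rw [segment_eq_image']
      rintro _ ⟨θ, hθ, rfl⟩
      have hr : (Y s₀, s₀) + θ • ((Y s, s) - (Y s₀, s₀)) =
          (Y (s₀ + θ • (s - s₀)), s₀ + θ • (s - s₀)) := by
        refine Prod.ext ?_ rfl
        simp only [hY, Prod.fst_add, Prod.smul_fst, Prod.fst_sub, smul_eq_mul]
        module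
      beta_reduce
      rw [hr]
      exact hΩ _ ((convex_Icc a b).add_smul_sub_mem hs₀ (Ioo_subset_Icc_self hs) hθ)
        ((convex_Ioo 0 P.T).add_smul_sub_mem hs₀T (hIoo s hs) hθ)
    have h1 := (convex_segment (𝕜 := ℝ) (Y s₀, s₀) (Y s, s)).norm_image_sub_le_of_norm_fderiv_le
      (fun z hz => h.differentiableAt_fderiv z (hseg hz))
      (fun z hz => h.norm_fderiv_fderiv_le z (hseg hz))
      (left_mem_segment ℝ _ _) (right_mem_segment ℝ _ _)
    have hss : |s - s₀| ≤ D := by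
      rw [abs_le]; constructor <;> linarith [hs₀.1, hs₀.2, hs.1, hs.2]
    have h2 : ‖((Y s, s) : Vec d × ℝ) - (Y s₀, s₀)‖ ≤ (M + 1) * D := by
      have : Y s - Y s₀ = (s - s₀) • β := by simp only [hY]; module
      rw [Prod.mk_sub_mk, Prod.norm_mk, this, norm_smul, Real.norm_eq_abs]
      have h3 : |s - s₀| * ‖β‖ ≤ D * M := mul_le_mul hss hβM (norm_nonneg _) hD0
      exact max_le (by nlinarith) (by nlinarith)
    have h3 := (norm_spaceGradient_sub_le v (Y s, s) (Y s₀, s₀)).trans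
      (h1.trans (mul_le_mul_of_nonneg_left h2 h.nonneg))
    have h4 := norm_sub_le_norm_sub_add_norm_sub (spaceGradient v (Y s, s))
      (spaceGradient v (Y s₀, s₀)) l
    linarith
  -- the mean value theorem for the value along the line, corrected by the expected increments
  obtain ⟨s, hs, hslope⟩ := exists_hasDerivAt_eq_slope
    (fun s => U s + ((s - a) * φ + (s - a) ^ 2 * (c / 2)))
    (fun s => fderiv ℝ v (Y s, s) (β, 1) + (φ + (s - a) * c)) hab
    (hU.add (by fun_prop)) (fun s hs => by
      have hYd : HasDerivAt (fun s => (Y s, s)) (β, (1 : ℝ)) s := by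
        refine HasDerivAt.prodMk ?_ (hasDerivAt_id s)
        exact ((((hasDerivAt_id s).sub_const a).smul_const β).const_add x).congr_deriv (by simp)
      have hvd := HasFDerivAt.comp_hasDerivAt (f := fun s => (Y s, s)) s
        (h.differentiableAt _ (hYΩ s hs)).hasFDerivAt hYd
      have hUd : HasDerivAt U (fderiv ℝ v (Y s, s) (β, 1)) s :=
        hvd.congr_of_eventuallyEq (by
          filter_upwards [Ioo_mem_nhds hs.1 hs.2] with r hr using hUv r hr)
      refine hUd.add ?_
      have h1 := (hasDerivAt_id s).sub_const a
      have h2 := (h1.mul_const φ).add ((h1.pow 2).mul_const (c / 2))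
      refine h2.congr_deriv ?_
      simp
      ring)
  have hsum : fderiv ℝ v (Y s, s) (β, 1) =
      inner ℝ (spaceGradient v (Y s, s)) β - H (Y s) (spaceGradient v (Y s, s)) := by
    have : ((β, 1) : Vec d × ℝ) = (β, 0) + (0, 1) := by simp
    rw [this, map_add, ← inner_spaceGradient,
      h.hamiltonJacobi hH hM (hIoo s hs).2 (hYΩ s hs), sub_eq_add_neg]
  set p := spaceGradient v (Y s, s) with hp
  have hYx : Y s - x = (s - a) • β := by simp only [hY]; module
  have hder : |fderiv ℝ v (Y s, s) (β, 1) + (φ + (s - a) * c)|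
      ≤ M * (M + K + L * (M + 1)) ^ 2 * D ^ 2 := by
    have htay := hM.abs_taylor_le x l (Y s) p
    rw [hYx, inner_smul_right, inner_sub_right, ← hβ] at htay
    have e : fderiv ℝ v (Y s, s) (β, 1) + (φ + (s - a) * c) =
        -(H (Y s) p - H x l - (s - a) * inner ℝ (gradX H x l) β
          - (inner ℝ β p - inner ℝ β l)) := by
      rw [hsum, hφ, hc, real_inner_comm β p, real_inner_comm β l, real_inner_comm β (gradX H x l)]
      ring
    rw [e, abs_neg]
    refine htay.trans ?_
    have h1 : ‖(s - a) • β‖ ≤ M * D := by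
      rw [norm_smul, Real.norm_eq_abs, abs_of_pos (sub_pos.2 hs.1), mul_comm]
      exact mul_le_mul hβM (by linarith [hs.2]) (sub_pos.2 hs.1).le hM0
    have h2 : ‖(s - a) • β‖ + ‖p - l‖ ≤ (M + K + L * (M + 1)) * D := by
      linarith [hgrad s hs]
    calc M * (‖(s - a) • β‖ + ‖p - l‖) ^ 2 ≤ M * ((M + K + L * (M + 1)) * D) ^ 2 := by gcongr
      _ = _ := by ring
  have hba : 0 < b - a := sub_pos.2 hab
  rw [eq_div_iff hba.ne'] at hslope
  have e2 : (b - a) * φ + U b - U a - (b - a) ^ 2 * (-c / 2)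
      = (fderiv ℝ v (Y s, s) (β, 1) + (φ + (s - a) * c)) * (b - a) := by
    rw [hslope]; ring
  rw [e2, abs_mul, abs_of_pos hba]
  exact mul_le_mul_of_nonneg_right hder hba.le

/-! ### The discrete problem -/

theorem TimeGrid.dt_pos {T : ℝ} (G : TimeGrid T) {n : ℕ} (hn : n < G.N) : 0 < G.dt n :=
  sub_pos.2 (G.t_lt n hn)

theorem TimeGrid.dt_le_dtMax {T : ℝ} (G : TimeGrid T) {n : ℕ} (hn : n < G.N) :
    G.dt n ≤ G.dtMax :=
  le_ciSup (f := fun k : Fin G.N => G.dt k) (Finite.bddAbove_range _) ⟨n, hn⟩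

theorem TimeGrid.t_lt_t {T : ℝ} (G : TimeGrid T) {k n : ℕ} (hk : k < n) (hn : n ≤ G.N) :
    G.t k < G.t n := by
  induction n, hk using Nat.le_induction with
  | base => exact G.t_lt k hn
  | succ n _ ih => exact (ih (by omega)).trans (G.t_lt n hn)

theorem TimeGrid.t_mem_Ioo {T : ℝ} (G : TimeGrid T) {n : ℕ} (h0 : 0 < n) (hn : n < G.N) :
    G.t n ∈ Ioo 0 T := by
  have h1 := G.t_lt_t h0 hn.le
  have h2 := G.t_lt_t hn le_rfl
  rw [G.t_zero] at h1
  rw [G.t_last] at h2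
  exact ⟨h1, h2⟩

theorem TimeGrid.t_mem_Icc {T : ℝ} (G : TimeGrid T) {n : ℕ} (hn : n ≤ G.N) :
    G.t n ∈ Icc 0 T := by
  have h0 : G.t 0 ≤ G.t n := by
    rcases Nat.eq_zero_or_pos n with rfl | h0
    · exact le_rfl
    · exact (G.t_lt_t h0 hn).le
  have h1 : G.t n ≤ G.t G.N := by
    rcases hn.eq_or_lt with rfl | h
    · exact le_rfl
    · exact (G.t_lt_t h le_rfl).le
  rw [G.t_zero] at h0
  rw [G.t_last] at h1
  exact ⟨h0, h1⟩

theorem TimeGrid.sum_dt {T : ℝ} (G : TimeGrid T) : ∑ n ∈ Finset.range G.N, G.dt n = T := by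
  simp only [TimeGrid.dt]
  rw [Finset.sum_range_sub, G.t_last, G.t_zero, sub_zero]

theorem TimeGrid.N_pos {T : ℝ} (hT : 0 < T) (G : TimeGrid T) : 0 < G.N := by
  rcases Nat.eq_zero_or_pos G.N with h | h
  · have := G.t_last
    rw [h, G.t_zero] at this
    exact absurd this hT.ne
  · exact h

theorem TimeGrid.dtMax_nonneg {T : ℝ} (hT : 0 < T) (G : TimeGrid T) : 0 ≤ G.dtMax :=
  (G.dt_pos (G.N_pos hT)).le.trans (G.dt_le_dtMax (G.N_pos hT))

theorem TimeGrid.dtMax_le {T : ℝ} (hT : 0 < T) (G : TimeGrid T) : G.dtMax ≤ T := by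
  have : Nonempty (Fin G.N) := ⟨⟨0, G.N_pos hT⟩⟩
  refine ciSup_le fun n => ?_
  rw [TimeGrid.dt]
  linarith [(G.t_mem_Icc (n := n + 1) n.2).2, (G.t_mem_Icc (n := n) n.2.le).1]

theorem TimeGrid.dt_zero_of_N_eq_one {T : ℝ} (G : TimeGrid T) (h : G.N = 1) : G.dt 0 = T := by
  have := G.t_last
  rw [h] at this
  rw [TimeGrid.dt, zero_add, this, G.t_zero, sub_zero]

theorem TimeGrid.dtMax_of_N_eq_one {T : ℝ} (hT : 0 < T) (G : TimeGrid T) (h : G.N = 1) :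
    G.dtMax = T :=
  le_antisymm (G.dtMax_le hT)
    ((G.dt_zero_of_N_eq_one h).symm.le.trans (G.dt_le_dtMax (by omega)))

theorem discreteValue_of_N_eq_one (g : Vec d → ℝ) (x : Vec d) {T : ℝ} {G G' : TimeGrid T}
    (h : G.N = 1) (h' : G'.N = 1) : discreteValue g H G 0 x = discreteValue g H G' 0 x := by
  simp [discreteValue, discreteCost, discretePath, h, h', G.dt_zero_of_N_eq_one h,
    G'.dt_zero_of_N_eq_one h']

/-- At the velocity `H_λ(x,l)` the supremum that defines `L` is attained at `l`. -/
theorem legendre_gradLam (hH : P.IsHamiltonian H) (hM : HamiltonianBounds H M) (x l : Vec d) :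
    legendre H x (gradLam H x l) = ((H x l - inner ℝ l (gradLam H x l) : ℝ) : EReal) := by
  refine le_antisymm (iSup_le fun k => ?_) (le_iSup_of_le l ?_)
  · rw [EReal.coe_le_coe_iff]
    have := le_supergradient hH hM x l k
    rw [inner_sub_right, real_inner_comm l (gradLam H x l)] at this
    linarith
  · rw [EReal.coe_le_coe_iff, real_inner_comm]
    linarith

theorem IsDiscreteSolution.discreteValue_eq (hH : P.IsHamiltonian H)
    (hM : HamiltonianBounds H M) {x₀ : Vec d} {T : ℝ} {G : TimeGrid T} {X lam : ℕ → Vec d}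
    {g : Vec d → ℝ} (h : IsDiscreteSolution g H x₀ G X lam) :
    discreteValue g H G 0 x₀ = (((∑ n ∈ Finset.range G.N, G.dt n *
      (H (X n) (lam (n + 1)) - inner ℝ (lam (n + 1)) (gradLam H (X n) (lam (n + 1)))))
        + g (X G.N) : ℝ) : EReal) := by
  obtain ⟨β, hβ, hX⟩ := h.minimizing
  have hβeq : ∀ n < G.N, β n = gradLam H (X n) (lam (n + 1)) := by
    intro n hn
    have h1 := h.state_step n hn
    rw [hX (n + 1) hn, hX n hn.le, discretePath, discretePath,
      Finset.sum_Ico_succ_top (Nat.zero_le n), ← add_assoc] at h1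
    have h2 := smul_right_injective _ (G.dt_pos hn).ne' (add_left_cancel h1)
    rw [h2, hX n hn.le, discretePath]
  have hval : discreteValue g H G 0 x₀ = discreteCost g H G 0 x₀ β :=
    le_antisymm (iInf_le _ β) (le_iInf hβ)
  have hcoe : ∀ (s : Finset ℕ) (φ : ℕ → ℝ),
      ((∑ n ∈ s, φ n : ℝ) : EReal) = ∑ n ∈ s, (φ n : EReal) := fun s φ =>
    map_sum (⟨⟨Real.toEReal, EReal.coe_zero⟩, EReal.coe_add⟩ : ℝ →+ EReal) φ s
  rw [hval, discreteCost, ← hX G.N le_rfl, EReal.coe_add, hcoe, Finset.range_eq_Ico]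
  congr 1
  refine Finset.sum_congr rfl fun n hn => ?_
  have hn' : n < G.N := (Finset.mem_Ico.1 hn).2
  rw [← hX n hn'.le, hβeq n hn', legendre_gradLam hH hM, ← EReal.coe_mul]

theorem IsDiscreteSolution.norm_sub_initial_le (hM : HamiltonianBounds H M) {x₀ : Vec d} {T : ℝ}
    {G : TimeGrid T} {X lam : ℕ → Vec d} {g : Vec d → ℝ}
    (h : IsDiscreteSolution g H x₀ G X lam) {n : ℕ} (hn : n ≤ G.N) : ‖X n - x₀‖ ≤ M * G.t n := by
  induction n with
  | zero => simp [h.initial, G.t_zero]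
  | succ n ih =>
    have h1 := ih (by omega)
    have h2 : ‖G.dt n • gradLam H (X n) (lam (n + 1))‖ ≤ G.dt n * M := by
      rw [norm_smul, Real.norm_eq_abs, abs_of_pos (G.dt_pos hn)]
      exact mul_le_mul_of_nonneg_left (hM.norm_gradLam_le _ _) (G.dt_pos hn).le
    rw [h.state_step n hn, add_sub_right_comm]
    refine (norm_add_le _ _).trans ((add_le_add h1 h2).trans_eq ?_)
    rw [TimeGrid.dt]; ring

/-! ### The global error -/

/-- The value function is finite and continuous along a straight line that stays in the smooth
region `Ω` at the times of `(0,T)`, the endpoints `0` and `T` included. -/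
theorem SmoothValueOn.continuousOn_line {Ω : Set (Vec d × ℝ)} {v : Vec d × ℝ → ℝ} {L : ℝ}
    (h : SmoothValueOn P Ω v L) (hH : P.IsHamiltonian H) (hM : HamiltonianBounds H M)
    (hg : Continuous P.g) {x₀ : Vec d} {σ K u₀ : ℝ} (hσ : 0 < σ)
    (hu₀ : P.value x₀ 0 = (u₀ : EReal))
    (hK : ∀ s ∈ Ioo 0 σ, ∀ y : Vec d, ‖y - x₀‖ ≤ M * s → |v (y, s) - u₀| ≤ K * s)
    {a b : ℝ} (ha : 0 ≤ a) (hb : b ≤ P.T) {x β : Vec d} (hx : a = 0 → x = x₀) (hβ : ‖β‖ ≤ M)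
    (hΩ : ∀ s ∈ Icc a b, s ∈ Ioo 0 P.T → (x + (s - a) • β, s) ∈ Ω) :
    ContinuousOn (fun s => (P.value (x + (s - a) • β) s).toReal) (Icc a b) := by
  set Y : ℝ → Vec d := fun s => x + (s - a) • β with hY
  have hYc : Continuous Y := by fun_prop
  set U : ℝ → ℝ := fun s => (P.value (Y s) s).toReal with hU
  have hYz : ∀ s ∈ Icc a b, a = 0 → ‖Y s - x₀‖ ≤ M * s := by
    intro s hs ha0
    simp only [hY, hx ha0, ha0, sub_zero, add_sub_cancel_left, norm_smul, Real.norm_eq_abs]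
    rw [abs_of_nonneg (ha.trans hs.1), mul_comm]
    exact mul_le_mul_of_nonneg_right hβ (ha.trans hs.1)
  have hUv : ∀ s ∈ Icc a b, s ∈ Ioo 0 P.T → U s = v (Y s, s) := fun s hs hsT => by
    have := h.value_eq _ (hΩ s hs hsT)
    simp only at this
    simp only [hU, hY, this, EReal.toReal_coe]
  have hfin : ∀ s ∈ Icc a b, 0 < s → P.value (Y s) s = (U s : EReal) := by
    intro s hs hs0
    rcases (hs.2.trans hb).lt_or_eq with hlt | heq
    · rw [hUv s hs ⟨hs0, hlt⟩, h.value_eq _ (hΩ s hs ⟨hs0, hlt⟩)]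
    · simp only [hU, heq, value_terminal hH hM, EReal.toReal_coe]
  intro s hs
  rcases (ha.trans hs.1).eq_or_lt with h0 | h0
  · -- at the initial time
    subst h0
    have ha0 : a = 0 := le_antisymm hs.1 ha
    have hY0 : Y 0 = x₀ := by simp [hY, ha0, hx ha0]
    have hU0 : U 0 = u₀ := by simp only [hU, hY0, hu₀, EReal.toReal_coe]
    rw [ContinuousWithinAt, tendsto_iff_norm_sub_tendsto_zero]
    have hlim : Tendsto (fun s : ℝ => |K| * |s|) (𝓝[Icc a b] 0) (𝓝 0) := by
      have : Continuous fun s : ℝ => |K| * |s| := by fun_prop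
      simpa using (this.tendsto 0).mono_left nhdsWithin_le_nhds
    refine squeeze_zero' (Eventually.of_forall fun _ => norm_nonneg _) ?_ hlim
    by_cases hT : 0 < P.T
    · filter_upwards [self_mem_nhdsWithin, eventually_nhdsWithin_of_eventually_nhds
        (eventually_lt_nhds hσ), eventually_nhdsWithin_of_eventually_nhds
        (eventually_lt_nhds hT)] with s hs hsσ hsT
      change |U s - U 0| ≤ _
      rcases (ha.trans hs.1).eq_or_lt with h0 | h0
      · rw [← h0]; simp
      · rw [hU0, hUv s hs ⟨h0, hsT⟩]
        refine (hK s ⟨h0, hsσ⟩ _ (hYz s hs ha0)).trans ?_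
        rw [abs_of_pos h0]
        exact mul_le_mul_of_nonneg_right (le_abs_self K) h0.le
    · filter_upwards [self_mem_nhdsWithin] with s hs
      have : s = 0 := le_antisymm ((hs.2.trans hb).trans (not_lt.1 hT)) (ha.trans hs.1)
      simp [this]
  rcases (hs.2.trans hb).lt_or_eq with hT | hT
  · -- at a time in `(0,T)`
    have hcont : ContinuousAt (fun r => v (Y r, r)) s :=
      ContinuousAt.comp (g := v) (f := fun r => (Y r, r))
        (h.differentiableAt _ (hΩ s hs ⟨h0, hT⟩)).continuousAt (by fun_prop)
    refine hcont.continuousWithinAt.congr_of_eventuallyEq ?_ (hUv s hs ⟨h0, hT⟩)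
    filter_upwards [self_mem_nhdsWithin, mem_nhdsWithin_of_mem_nhds (Ioo_mem_nhds h0 hT)]
      with r hr hrT using hUv r hr hrT
  · -- at the terminal time
    have hUs : U s = P.g (Y s) := by
      simp only [hU, hT, value_terminal hH hM, EReal.toReal_coe]
    rw [Metric.continuousWithinAt_iff']
    intro η hη
    obtain ⟨δ, hδ, hterm⟩ := value_continuous_terminal hH hM hg (Y s) hη
    filter_upwards [self_mem_nhdsWithin, eventually_nhdsWithin_of_eventually_nhds
      (eventually_gt_nhds h0), eventually_nhdsWithin_of_eventually_nhds
      (eventually_gt_nhds (show P.T - δ < s by linarith)),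
      mem_nhdsWithin_of_mem_nhds (hYc.continuousAt.preimage_mem_nhds
        (Metric.ball_mem_nhds (Y s) hδ))] with r hr hr0 hrδ hrY
    rw [Real.dist_eq, hUs]
    refine hterm (Y r) r (U r) ?_ hrδ (hr.2.trans hb) (hfin r hr hr0)
    rwa [← dist_eq_norm]

/-- The error representation for grids with at least two steps whose discrete path stays well
inside a tube around `Z` in which the value function is smooth. Every step of such a grid has an
endpoint in `(0,T)`, where the gradient of the value function exists. -/
theorem SmoothValueOn.exists_errorRepresentation (hT : 0 < P.T) (hH : P.IsHamiltonian H)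
    (hM : HamiltonianBounds H M) (hg : Continuous P.g) {Z : ℝ → Vec d} {ε L : ℝ} (hε : 0 < ε)
    {v : Vec d × ℝ → ℝ}
    (hZ : ∀ r ∈ Icc 0 P.T, ∀ s ∈ Icc 0 P.T, ‖Z s - Z r‖ ≤ M * |s - r|)
    (h : SmoothValueOn P {p : Vec d × ℝ | p.2 ∈ Ioo 0 P.T ∧ ‖p.1 - Z p.2‖ < ε} v L) (C : ℝ) :
    ∃ u₀ : ℝ, P.value (Z 0) 0 = (u₀ : EReal) ∧
    ∃ C' : ℝ, ∀ (G : TimeGrid P.T) (X lam : ℕ → Vec d),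
      IsDiscreteSolution P.g H (Z 0) G X lam → 2 ≤ G.N →
      (∀ n ≤ G.N, ‖X n - Z (G.t n)‖ + 2 * M * G.dtMax < ε) →
      (∀ n ≤ G.N, ∀ p, EHasGradientAt (fun x => P.value x (G.t n)) p (X n) →
        ‖lam n - p‖ ≤ C * G.dtMax) →
      ErrorRepresentation P H (Z 0) G X lam C' := by
  have hM0 := hM.nonneg
  set Ω := {p : Vec d × ℝ | p.2 ∈ Ioo 0 P.T ∧ ‖p.1 - Z p.2‖ < ε} with hΩdef
  set σ := min P.T (ε / (2 * M + 1)) with hσdef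
  have hσ : 0 < σ := by positivity
  have hσT : σ ≤ P.T := min_le_left _ _
  have h0T : (0 : ℝ) ∈ Icc 0 P.T := ⟨le_rfl, hT.le⟩
  have hcone : ∀ s ∈ Ioo 0 σ, ∀ y : Vec d, ‖y - Z 0‖ ≤ M * s → (y, s) ∈ Ω := by
    intro s hs y hy
    have hsT : s < P.T := hs.2.trans_le hσT
    have h1 := hZ s ⟨hs.1.le, hsT.le⟩ 0 h0T
    rw [zero_sub, abs_neg, abs_of_pos hs.1] at h1
    have h2 : s < ε / (2 * M + 1) := hs.2.trans_le (min_le_right _ _)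
    rw [lt_div_iff₀ (by positivity)] at h2
    refine ⟨⟨hs.1, hsT⟩, ?_⟩
    change ‖y - Z s‖ < ε
    have := norm_sub_le_norm_sub_add_norm_sub y (Z 0) (Z s)
    linarith [hs.1]
  obtain ⟨u₀, hu₀, K, hK⟩ := exists_value_initial hH hM (v := v) (x₀ := Z 0) hσ hσT h.nonneg
    (fun s hs y hy => h.value_eq _ (hcone s hs y hy)) (fun s hs y y' hy hy' => by
      have hsub : Metric.ball (Z s) ε ×ˢ {s} ⊆ Ω := by
        rintro ⟨z, r⟩ ⟨hz, rfl⟩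
        exact ⟨⟨hs.1, hs.2.trans_le hσT⟩, by simpa [dist_eq_norm] using hz⟩
      have hmem : ∀ z : Vec d, ‖z - Z 0‖ ≤ M * s → ((z, s) : Vec d × ℝ) ∈
          Metric.ball (Z s) ε ×ˢ ({s} : Set ℝ) := fun z hz =>
        ⟨by simpa [dist_eq_norm] using (hcone s hs z hz).2, rfl⟩
      have := ((convex_ball (Z s) ε).prod (convex_singleton s)).norm_image_sub_le_of_norm_fderiv_le
        (fun z hz => h.differentiableAt z (hsub hz)) (fun z hz => h.norm_fderiv_le z (hsub hz))
        (hmem y' hy') (hmem y hy)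
      refine this.trans_eq ?_
      rw [Prod.mk_sub_mk, sub_self, Prod.norm_mk, norm_zero, max_eq_left (norm_nonneg _)])
  refine ⟨u₀, hu₀, M * (M + (|C| + M) + L * (M + 1)) ^ 2 * P.T, ?_⟩
  intro G X lam hsol hN hdist hdual
  set D := G.dtMax with hD
  have hD0 : 0 ≤ D := G.dtMax_nonneg hT
  set C₁ := M * (M + (|C| + M) + L * (M + 1)) ^ 2 with hC₁
  set u : ℕ → ℝ := fun n => (P.value (X n) (G.t n)).toReal with hu
  set φ : ℕ → ℝ := fun n =>
    H (X n) (lam (n + 1)) - inner ℝ (lam (n + 1)) (gradLam H (X n) (lam (n + 1))) with hφ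
  -- the dual variables are close to the gradients of the value at the interior nodes
  have hinterior : ∀ n, 0 < n → n < G.N → (X n, G.t n) ∈ Ω ∧
      ‖spaceGradient v (X n, G.t n) - lam n‖ ≤ |C| * D := by
    intro n h0 hn
    have hmem : (X n, G.t n) ∈ Ω := by
      refine ⟨G.t_mem_Ioo h0 hn, ?_⟩
      change ‖X n - Z (G.t n)‖ < ε
      have : 0 ≤ 2 * M * D := by positivity
      linarith [hdist n hn.le]
    refine ⟨hmem, ?_⟩
    rw [norm_sub_rev]
    exact (hdual n hn.le _ (h.eHasGradientAt hmem)).trans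
      (mul_le_mul_of_nonneg_right (le_abs_self C) hD0)
  have hlocal : ∀ n < G.N, |G.dt n * φ n + u (n + 1) - u n
      - G.dt n ^ 2 * errorDensity H X lam n| ≤ C₁ * D ^ 2 * G.dt n := by
    intro n hn
    have ha := G.t_mem_Icc hn.le
    have hb := G.t_mem_Icc (n := n + 1) hn
    set β := gradLam H (X n) (lam (n + 1)) with hβ
    have hβM : ‖β‖ ≤ M := hM.norm_gradLam_le _ _
    have hstep : X n + (G.t (n + 1) - G.t n) • β = X (n + 1) := (hsol.state_step n hn).symm
    have hstart : X n + (G.t n - G.t n) • β = X n := by simp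
    have hline : ∀ s ∈ Icc (G.t n) (G.t (n + 1)), s ∈ Ioo 0 P.T →
        (X n + (s - G.t n) • β, s) ∈ Ω := by
      intro s hs hsT
      refine ⟨hsT, ?_⟩
      change ‖X n + (s - G.t n) • β - Z s‖ < ε
      have hsD : s - G.t n ≤ D := (sub_le_sub_right hs.2 _).trans (G.dt_le_dtMax hn)
      have hs0 : 0 ≤ s - G.t n := sub_nonneg.2 hs.1
      have h1 := hZ s ⟨hsT.1.le, hsT.2.le⟩ (G.t n) ha
      rw [abs_sub_comm, abs_of_nonneg hs0] at h1
      have h2 : ‖(s - G.t n) • β‖ ≤ M * D := by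
        rw [norm_smul, Real.norm_eq_abs, abs_of_nonneg hs0, mul_comm]
        exact mul_le_mul hβM hsD hs0 hM0
      have h3 : M * (s - G.t n) ≤ M * D := mul_le_mul_of_nonneg_left hsD hM0
      have h4 : X n + (s - G.t n) • β - Z s
          = (X n - Z (G.t n)) + ((s - G.t n) • β + (Z (G.t n) - Z s)) := by abel
      have h5 := norm_add_le (X n - Z (G.t n)) ((s - G.t n) • β + (Z (G.t n) - Z s))
      have h6 := norm_add_le ((s - G.t n) • β) (Z (G.t n) - Z s)
      rw [h4]
      linarith [hdist n hn.le]
    have hcont := h.continuousOn_line hH hM hg hσ hu₀ hK ha.1 hb.2 (x := X n) (fun h0 => by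
      rcases Nat.eq_zero_or_pos n with rfl | hpos
      · exact hsol.initial
      · exact absurd h0 (G.t_mem_Ioo hpos hn).1.ne') hβM hline
    -- an endpoint of the step at which the gradient of the value exists
    obtain ⟨s₀, hs₀, hs₀T, hl⟩ : ∃ s₀ ∈ Icc (G.t n) (G.t (n + 1)), s₀ ∈ Ioo 0 P.T ∧
        ‖spaceGradient v (X n + (s₀ - G.t n) • β, s₀) - lam (n + 1)‖ ≤ (|C| + M) * D := by
      rcases Nat.eq_zero_or_pos n with rfl | hpos
      · refine ⟨G.t (0 + 1), ⟨(G.t_lt 0 hn).le, le_rfl⟩, G.t_mem_Ioo (by omega) (by omega), ?_⟩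
        rw [hstep]
        linarith [(hinterior (0 + 1) (by omega) (by omega)).2, mul_nonneg hM0 hD0]
      · refine ⟨G.t n, ⟨le_rfl, (G.t_lt n hn).le⟩, G.t_mem_Ioo hpos hn, ?_⟩
        rw [hstart]
        have h1 : ‖lam n - lam (n + 1)‖ ≤ M * D := by
          rw [hsol.dual_step n hn, add_sub_cancel_left, norm_smul, Real.norm_eq_abs,
            abs_of_pos (G.dt_pos hn), mul_comm]
          exact mul_le_mul (hM.norm_gradX_le _ _) (G.dt_le_dtMax hn) (G.dt_pos hn).le hM0
        linarith [(hinterior n hpos hn).2, norm_sub_le_norm_sub_add_norm_sub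
          (spaceGradient v (X n, G.t n)) (lam n) (lam (n + 1))]
    have hmain := h.abs_local_error_le hH hM (G.t_lt n hn) ha.1 hb.2 (G.dt_le_dtMax hn)
      hcont hline (fun s hs => by
        rw [h.value_eq _ (hline s (Ioo_subset_Icc_self hs)
          ⟨ha.1.trans_lt hs.1, hs.2.trans_le hb.2⟩), EReal.toReal_coe]) hs₀ hs₀T hl
    simp only [← hβ, hstep, hstart] at hmain
    exact hmain
  have huN : u G.N = P.g (X G.N) := by
    simp only [hu, G.t_last, value_terminal hH hM, EReal.toReal_coe]
  have hu0 : u 0 = u₀ := by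
    simp only [hu, G.t_zero, hsol.initial, hu₀, EReal.toReal_coe]
  refine ⟨_, u₀, ∑ n ∈ Finset.range G.N, (G.dt n * φ n + u (n + 1) - u n
    - G.dt n ^ 2 * errorDensity H X lam n), hsol.discreteValue_eq hH hM, hu₀, ?_, ?_⟩
  · have htel := Finset.sum_range_sub u G.N
    rw [huN, hu0] at htel
    have hsplit : ∑ n ∈ Finset.range G.N, (G.dt n * φ n + u (n + 1) - u n
          - G.dt n ^ 2 * errorDensity H X lam n)
        = ∑ n ∈ Finset.range G.N, G.dt n * φ n + ∑ n ∈ Finset.range G.N, (u (n + 1) - u n)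
          - ∑ n ∈ Finset.range G.N, G.dt n ^ 2 * errorDensity H X lam n := by
      rw [← Finset.sum_add_distrib, ← Finset.sum_sub_distrib]
      exact Finset.sum_congr rfl fun n _ => by ring
    rw [hsplit, htel]
    ring
  · refine (Finset.abs_sum_le_sum_abs _ _).trans
      ((Finset.sum_le_sum fun n hn => hlocal n (Finset.mem_range.1 hn)).trans_eq ?_)
    rw [← Finset.mul_sum, G.sum_dt]
    ring

theorem ErrorRepresentation.mono {x₀ : Vec d} {G : TimeGrid P.T} {X lam : ℕ → Vec d} {C C' : ℝ}
    (h : ErrorRepresentation P H x₀ G X lam C) (hC : C ≤ C') :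
    ErrorRepresentation P H x₀ G X lam C' := by
  obtain ⟨a, b, R, h1, h2, h3, h4⟩ := h
  exact ⟨a, b, R, h1, h2, h3, h4.trans (mul_le_mul_of_nonneg_right hC (sq_nonneg _))⟩

/-- Grids with a single step all give the same discrete value, and `Δt_max = T` for them, so a
bounded remainder is good enough. -/
theorem exists_errorRepresentation_of_N_eq_one (hT : 0 < P.T) (hH : P.IsHamiltonian H)
    (hM : HamiltonianBounds H M) {x₀ : Vec d} {u₀ : ℝ} (hu₀ : P.value x₀ 0 = (u₀ : EReal)) :
    ∃ C' : ℝ, ∀ (G : TimeGrid P.T) (X lam : ℕ → Vec d), IsDiscreteSolution P.g H x₀ G X lam →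
      G.N = 1 → ErrorRepresentation P H x₀ G X lam C' := by
  by_cases hex : ∃ (G : TimeGrid P.T) (X lam : ℕ → Vec d),
      IsDiscreteSolution P.g H x₀ G X lam ∧ G.N = 1
  · obtain ⟨G₁, X₁, lam₁, hsol₁, hN₁⟩ := hex
    have hval := hsol₁.discreteValue_eq hH hM
    set w := (∑ n ∈ Finset.range G₁.N, G₁.dt n * (H (X₁ n) (lam₁ (n + 1)) -
      inner ℝ (lam₁ (n + 1)) (gradLam H (X₁ n) (lam₁ (n + 1))))) + P.g (X₁ G₁.N)
    refine ⟨(|w - u₀| + P.T ^ 2 * M ^ 2) / P.T ^ 2, fun G X lam hsol hN => ?_⟩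
    refine ⟨w, u₀, w - u₀ - ∑ n ∈ Finset.range G.N, G.dt n ^ 2 * errorDensity H X lam n,
      (discreteValue_of_N_eq_one P.g x₀ hN hN₁).trans hval, hu₀, by ring, ?_⟩
    have hρ : |errorDensity H X lam 0| ≤ M ^ 2 := by
      have h1 := abs_real_inner_le_norm (gradLam H (X 0) (lam (0 + 1)))
        (gradX H (X 0) (lam (0 + 1)))
      have h2 := mul_le_mul (hM.norm_gradLam_le (X 0) (lam (0 + 1)))
        (hM.norm_gradX_le (X 0) (lam (0 + 1))) (norm_nonneg _) hM.nonneg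
      rw [errorDensity, abs_div, abs_neg, abs_of_pos (two_pos : (0 : ℝ) < 2)]
      have h3 := sq_nonneg M
      linarith
    rw [G.dtMax_of_N_eq_one hT hN, div_mul_cancel₀ _ (by positivity), hN, Finset.sum_range_one,
      G.dt_zero_of_N_eq_one hN]
    refine (abs_sub _ _).trans ?_
    rw [abs_mul, abs_of_nonneg (sq_nonneg P.T)]
    gcongr
  · exact ⟨0, fun G X lam hsol hN => absurd ⟨G, X, lam, hsol, hN⟩ hex⟩

/-- A tube around a path that is continuous on `[0,T]` is open. -/
theorem isOpen_tube {T ε : ℝ} {Z : ℝ → Vec d} (hZ : ContinuousOn Z (Icc 0 T)) :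
    IsOpen {p : Vec d × ℝ | p.2 ∈ Ioo 0 T ∧ ‖p.1 - Z p.2‖ < ε} := by
  have hopen : IsOpen {p : Vec d × ℝ | p.2 ∈ Ioo 0 T} := isOpen_Ioo.preimage continuous_snd
  have hc : ContinuousOn (fun p : Vec d × ℝ => ‖p.1 - Z p.2‖) {p | p.2 ∈ Ioo 0 T} :=
    (continuousOn_fst.sub (hZ.comp continuousOn_snd
      fun p hp => Ioo_subset_Icc_self hp)).norm
  exact hc.isOpen_inter_preimage hopen isOpen_Iio

theorem EBoundedCk.mono {E : Type*} [NormedAddCommGroup E] [NormedSpace ℝ E] {k : ℕ}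
    {w : E → EReal} {U V : Set E} (h : EBoundedCk k w U) (hVU : V ⊆ U) : EBoundedCk k w V := by
  obtain ⟨v, hv, hc, K, hK⟩ := h
  exact ⟨v, fun p hp => hv p (hVU hp), hc.mono hVU, K, fun j h1 h2 p hp => hK j h1 h2 p (hVU hp)⟩

end SymplecticEuler

open SymplecticEuler

theorem theorem2p3 {d m : ℕ} (P : SymplecticEuler.ControlProblem d m) (hT : 0 < P.T)
    (H : SymplecticEuler.Vec d → SymplecticEuler.Vec d → ℝ) (hH : P.IsHamiltonian H)
    (hstanding : SymplecticEuler.StandingConditions P.g H)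
    (hC2 : SymplecticEuler.BoundedCk 2
      (fun p : SymplecticEuler.Vec d × SymplecticEuler.Vec d => H p.1 p.2) Set.univ)
    (x₀ : SymplecticEuler.Vec d)
    -- for every discretization, a discrete minimizing path and a discrete dual path
    (X lam : SymplecticEuler.TimeGrid P.T → ℕ → SymplecticEuler.Vec d)
    (hsol : ∀ G, SymplecticEuler.IsDiscreteSolution P.g H x₀ G (X G) (lam G))
    -- `|λ_n - u_x(X_n,t_n)| ≤ C Δt_max`, wherever `u_x(X_n,t_n)` exists
    (hdual : ∃ C : ℝ, ∀ G : SymplecticEuler.TimeGrid P.T, ∀ n, n ≤ G.N →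
      ∀ p, SymplecticEuler.EHasGradientAt (fun x => P.value x (G.t n)) p (X G n) →
        ‖lam G n - p‖ ≤ C * G.dtMax) :
    (SymplecticEuler.GloballySmoothValue P →
      ∃ C' : ℝ, ∀ G : SymplecticEuler.TimeGrid P.T,
        SymplecticEuler.ErrorRepresentation P H x₀ G (X G) (lam G) C') ∧
    (SymplecticEuler.SmoothNearOptimalPath P x₀ X →
      ∃ dtThres : ℝ, 0 < dtThres ∧ ∃ C' : ℝ, ∀ G : SymplecticEuler.TimeGrid P.T,
        G.dtMax ≤ dtThres →
          SymplecticEuler.ErrorRepresentation P H x₀ G (X G) (lam G) C') := by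
  obtain ⟨M, hM⟩ := exists_hamiltonianBounds hC2
  obtain ⟨C, hC⟩ := hdual
  have hM0 := hM.nonneg
  have hg := hstanding.continuous_g
  constructor
  · intro hglob
    -- the discrete paths have speed at most `M`, so they stay in this tube around the constant path
    set ε := 3 * M * P.T + 1 with hε
    have hε0 : 0 < ε := by positivity
    obtain ⟨Z, hZ⟩ : ∃ Z : ℝ → Vec d, ∀ s, Z s = x₀ := ⟨fun _ => x₀, fun _ => rfl⟩
    have hZc : Continuous Z := (funext hZ : Z = fun _ => x₀) ▸ continuous_const
    have htube : EBoundedCk 3 (fun p : Vec d × ℝ => P.value p.1 p.2)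
        {p | p.2 ∈ Set.Ioo 0 P.T ∧ ‖p.1 - Z p.2‖ < ε} := hglob.mono fun p hp => hp.1
    obtain ⟨v, L, hv⟩ := htube.exists_smoothValueOn (isOpen_tube hZc.continuousOn)
    obtain ⟨u₀, hu₀, C₂, hC₂⟩ := hv.exists_errorRepresentation hT hH hM hg hε0
      (fun r _ s _ => by
        rw [hZ, hZ, sub_self, norm_zero]; exact mul_nonneg hM0 (abs_nonneg _)) C
    simp only [hZ] at hu₀ hC₂
    obtain ⟨C₁, hC₁⟩ := exists_errorRepresentation_of_N_eq_one hT hH hM hu₀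
    refine ⟨max C₁ C₂, fun G => ?_⟩
    rcases (show G.N = 1 ∨ 2 ≤ G.N by have := G.N_pos hT; omega) with hN | hN
    · exact (hC₁ G _ _ (hsol G) hN).mono (le_max_left _ _)
    · refine (hC₂ G _ _ (hsol G) hN (fun n hn => ?_) (hC G)).mono (le_max_right _ _)
      have h1 := (hsol G).norm_sub_initial_le hM hn
      have h2 := mul_le_mul_of_nonneg_left (G.t_mem_Icc hn).2 hM0
      have h3 := mul_le_mul_of_nonneg_left (G.dtMax_le hT) hM0
      linarith
  · rintro ⟨Z, ⟨α, hα, -⟩, ⟨ε, hε, hsmooth⟩, hconv⟩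
    have hZ0 : Z 0 = x₀ := hα.apply_initial hT.le
    have hZlip : ∀ r ∈ Set.Icc 0 P.T, ∀ s ∈ Set.Icc 0 P.T, ‖Z s - Z r‖ ≤ M * |s - r| :=
      fun r hr s hs => hα.norm_sub_le hH hM hr hs
    have hZc : ContinuousOn Z (Set.Icc 0 P.T) :=
      (LipschitzOnWith.of_dist_le_mul (K := M.toNNReal) fun s hs r hr => by
        simpa [dist_eq_norm, hM0] using hZlip r hr s hs).continuousOn
    obtain ⟨v, L, hv⟩ := hsmooth.exists_smoothValueOn (isOpen_tube hZc)
    obtain ⟨u₀, -, C', hC'⟩ := hv.exists_errorRepresentation hT hH hM hg hε hZlip C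
    obtain ⟨δ, hδ, hXZ⟩ := hconv (ε / 2) (by positivity)
    -- below `T` the threshold excludes grids with a single step
    refine ⟨min (P.T / 2) (min (δ / 2) (ε / (4 * M + 4))), by positivity, C', fun G hG => ?_⟩
    rw [le_min_iff, le_min_iff, le_div_iff₀ (by positivity : (0 : ℝ) < 4 * M + 4)] at hG
    obtain ⟨hGT, hGδ, hGε⟩ := hG
    have hN : 2 ≤ G.N := by
      by_contra hlt
      have := G.dtMax_of_N_eq_one hT (by have := G.N_pos hT; omega)
      linarith
    have hD0 : 0 < G.dtMax := (G.dt_pos (G.N_pos hT)).trans_le (G.dt_le_dtMax (G.N_pos hT))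
    rw [← hZ0]
    refine hC' G _ _ (hZ0 ▸ hsol G) hN (fun n hn => ?_) (hC G)
    have := hXZ G (by linarith) n hn
    linarith
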